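/- Let $d\ge 1$, $\mathbb R^d_+=[0,\infty)^d$ with Lebesgue measure, and let $p,q,r$ be real numbers such that either $1\le q<\min(p,r)$, or $1\le q=r<p$, or $1\le q=p<r$. For real $\theta,\theta_0$ and $\theta_1>0$ put $w(t)=(t_1^2+\dots+t_d^2)^{\theta/2}$, $w_0(t)=(t_1^2+\dots+t_d^2)^{\theta_0/2}$, $w_j(t)=t_j^{\theta_1}$ ($j=1,\dots,d$). For $\omega\in\Pi_+^{d-1}=[0,\pi/2]^{d-1}$ let $\tilde t_j(\omega)=\sin\omega_1\cdots\sin\omega_{j-1}\cos\omega_j$ for $j<d$, $\tilde t_d(\omega)=\sin\omega_1\cdots\sin\omega_{d-1}$, and $J(\omega)=\sin^{d-2}\omega_1\sin^{d-3}\omega_2\cdots\sin\omega_{d-2}$ (empty products are $1$, and for $d=1$ the integral over the one-point set $\Pi_+^0$ is the value of the integrand). Let $B$ be the Euler beta function. Functions $x$ are measurable with values in $\mathbb R$ or in $\mathbb C$. An inequality with a constant is called sharp if it fails with every smaller constant. (i) Put $\tilde\theta=\theta+d/q$, $\tilde\theta_0=\theta_0+d/p$, $\tilde\theta_1=\theta_1+d/r$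 and suppose that $\theta_1+d(1/r-1/q)>\theta>\theta_0+d(1/p-1/q)$ or $\theta_1+d(1/r-1/q)<\theta<\theta_0+d(1/p-1/q)$. Put $\tilde\gamma=(\tilde\theta_1-\tilde\theta)/(\tilde\theta_1-\tilde\theta_0)$ and $1/\tilde q=1/q-\tilde\gamma/p-(1-\tilde\gamma)/r$. Then $$\tilde I=\int_{\Pi_+^{d-1}}\frac{J(\omega)\,d\omega}{\bigl(\sum_{k=1}^d\tilde t_k(\omega)^{r\theta_1}\bigr)^{\tilde q(1-\tilde\gamma)/r}}<\infty,$$ and for all $x$ with $w_0x\in L_p(\mathbb R^d_+)$ and $w_jx\in L_r(\mathbb R^d_+)$, $j=1,\dots,d$, the sharp inequality $$\|wx\|_{L_q(\mathbb R^d_+)}\le\tilde C\,\|w_0x\|_{L_p(\mathbb R^d_+)}^{\tilde\gamma}\Bigl(\max_{1\le j\le d}\|w_jx\|_{L_r(\mathbb R^d_+)}\Bigr)^{1-\tilde\gamma}$$ holds with $$\tilde C=\tilde\gamma^{-\tilde\gamma/p}\Bigl(\frac{1-\tilde\gamma}d\Bigr)^{-(1-\tilde\gamma)/r}\left(\frac{B\bigl(\tilde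 q\tilde\gamma/p,\tilde q(1-\tilde\gamma)/r\bigr)\tilde I}{|\tilde\theta_1-\tilde\theta_0|\,(\tilde\gamma r+(1-\tilde\gamma)p)}\right)^{1/\tilde q}.$$ (ii) Let $\lambda,\mu>0$, $\theta=d(1-1/q)$, $\theta_0=d-(\lambda+d)/p$, $\theta_1=d+(\mu-d)/r$, $\alpha=\mu/(p\mu+r\lambda)$, $\beta=\lambda/(p\mu+r\lambda)$. Then $$I=\int_{\Pi_+^{d-1}}\frac{J(\omega)\,d\omega}{\bigl(\sum_{k=1}^d\tilde t_k(\omega)^{d(r-1)+\mu}\bigr)^{\beta/(1/q-\alpha-\beta)}}<\infty,$$ and for all $x$ with $w_0x\in L_p(\mathbb R^d_+)$ and $w_jx\in L_r(\mathbb R^d_+)$, $j=1,\dots,d$, the sharp inequality $$\|wx\|_{L_q(\mathbb R^d_+)}\le C\,\|w_0x\|_{L_p(\mathbb R^d_+)}^{p\alpha}\Bigl(\max_{1\le j\le d}\|w_jx\|_{L_r(\mathbb R^d_+)}\Bigr)^{r\beta}$$ holds with $$C=\frac{d^\beta}{(p\alpha)^\alpha(r\beta)^\beta}\left(\frac I{\lambda+\mu}\,B\Bigl(\frac\alpha{1/q-\alpha-\beta},\frac\beta{1/q-\alpha-\beta}\Bigr)\right)^{1/q-\alpha-\beta}.$$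 -/

import Mathlib

open MeasureTheory Set
open scoped ENNReal

noncomputable section

namespace Carlson

/-- The admissible triples `(p, q, r)`: the union of `1 ≤ q < p, r`, of `1 ≤ q = r < p`
and of `1 ≤ q = p < r`. -/
def P : Set (ℝ × ℝ × ℝ) := {s | 1 ≤ s.2.1 ∧ s.2.1 < s.1 ∧ s.2.1 < s.2.2}

/-- The triples `(p, q, r)` with `1 ≤ q = r < p`. -/
def P₁ : Set (ℝ × ℝ × ℝ) := {s | 1 ≤ s.2.1 ∧ s.2.1 = s.2.2 ∧ s.2.1 < s.1}

/-- The triples `(p, q, r)` with `1 ≤ q = p < r`. -/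
def P₂ : Set (ℝ × ℝ × ℝ) := {s | 1 ≤ s.2.1 ∧ s.2.1 = s.1 ∧ s.2.1 < s.2.2}

/-- Lebesgue measure on `ℝ₊ᵈ = [0, ∞)ᵈ`. -/
def orthantMeasure (d : ℕ) : Measure (Fin d → ℝ) :=
  (volume : Measure (Fin d → ℝ)).restrict {t | ∀ i, 0 ≤ t i}

/-- The radial weight `|t|^θ = (t₁² + ⋯ + t_d²)^(θ/2)`. -/
def radialWeight (d : ℕ) (θ : ℝ) (t : Fin d → ℝ) : ℝ := (∑ i, t i ^ 2) ^ (θ / 2)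

/-- The coordinate weight `t_j^θ₁`. -/
def coordWeight (d : ℕ) (θ₁ : ℝ) (j : Fin d) (t : Fin d → ℝ) : ℝ := t j ^ θ₁

/-- The norm `‖w x‖` in `L_s(ℝ₊ᵈ)` (it is `∞` when `w x` is not in this space). -/
def weightedNorm {𝕜 : Type*} [RCLike 𝕜] {d : ℕ} (s : ℝ) (w : (Fin d → ℝ) → ℝ)
    (x : (Fin d → ℝ) → 𝕜) : ℝ≥0∞ :=
  eLpNorm (fun t => w t • x t) (ENNReal.ofReal s) (orthantMeasure d)

/-- `w x` belongs to `L_s(ℝ₊ᵈ)`. -/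
def MemWeighted {𝕜 : Type*} [RCLike 𝕜] {d : ℕ} (s : ℝ) (w : (Fin d → ℝ) → ℝ)
    (x : (Fin d → ℝ) → 𝕜) : Prop :=
  MemLp (fun t => w t • x t) (ENNReal.ofReal s) (orthantMeasure d)

/-- With `w = |t|^θ`, `w₀ = |t|^θ₀` and `w_j = t_j^θ₁`, `j = 1, …, d`: for all `𝕜`-valued `x`
such that `w₀ x ∈ L_p(ℝ₊ᵈ)` and `w_j x ∈ L_r(ℝ₊ᵈ)` for all `j`, one has
`‖w x‖_q ≤ K ‖w₀ x‖_p ^ a * (max_j ‖w_j x‖_r) ^ b`. -/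
def CarlsonInequality (𝕜 : Type*) [RCLike 𝕜] (d : ℕ) (p q r θ θ₀ θ₁ a b : ℝ) (K : ℝ≥0∞) : Prop :=
  ∀ x : (Fin d → ℝ) → 𝕜, MemWeighted p (radialWeight d θ₀) x →
    (∀ j, MemWeighted r (coordWeight d θ₁ j) x) →
    weightedNorm q (radialWeight d θ) x ≤
      K * weightedNorm p (radialWeight d θ₀) x ^ a *
        (⨆ j, weightedNorm r (coordWeight d θ₁ j) x) ^ b

/-- The inequality holds with the nonnegative real constant `C`, and with no smaller one. -/
def IsSharpConstant (𝕜 : Type*) [RCLike 𝕜] (d : ℕ) (p q r θ θ₀ θ₁ a b C : ℝ) : Prop :=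
  0 ≤ C ∧ IsLeast {K : ℝ≥0∞ | CarlsonInequality 𝕜 d p q r θ θ₀ θ₁ a b K} (ENNReal.ofReal C)

/-- The coordinates of the point of the unit sphere with polar angles `ω`:
`sin ω₁ ⋯ sin ω_{j-1} cos ω_j` for `j < d`, and `sin ω₁ ⋯ sin ω_{d-1}` for `j = d`. -/
def sphereCoord (d : ℕ) (ω : Fin (d - 1) → ℝ) (j : Fin d) : ℝ :=
  (∏ i : Fin (d - 1), if i.val < j.val then Real.sin (ω i) else 1) *
    if h : j.val < d - 1 then Real.cos (ω ⟨j.val, h⟩) else 1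

/-- The angular Jacobian `J(ω) = sin^{d-2} ω₁ sin^{d-3} ω₂ ⋯ sin ω_{d-2}`. -/
def angularJacobian (d : ℕ) (ω : Fin (d - 1) → ℝ) : ℝ :=
  ∏ i : Fin (d - 1), Real.sin (ω i) ^ (d - 2 - i.val)

/-- The cube `Π₊^{d-1} = [0, π/2]^{d-1}` (a single point of measure one if `d = 1`). -/
def angularCube (d : ℕ) : Set (Fin (d - 1) → ℝ) := {ω | ∀ i, ω i ∈ Icc 0 (Real.pi / 2)}

/-- The integrand `J(ω) / (∑ₖ t̃ₖ(ω)^e)^m`. -/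
def angularIntegrand (d : ℕ) (e m : ℝ) (ω : Fin (d - 1) → ℝ) : ℝ :=
  angularJacobian d ω / (∑ k, sphereCoord d ω k ^ e) ^ m

/-- The angular integral of `J(ω) / (∑ₖ t̃ₖ(ω)^e)^m` over `Π₊^{d-1}`. -/
def angularIntegral (d : ℕ) (e m : ℝ) : ℝ :=
  ∫ ω in angularCube d, angularIntegrand d e m ω

end Carlson

end

noncomputable section

namespace Carlson

/-! Put W = ∑ⱼ tⱼ^(rθ₁) and z = |x|. Summing over j gives ∫ W z^r ≤ d · (maxⱼ ‖wⱼx‖_r)^r, so the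
task is to bound ∫ w^q z^q in terms of ∫ w₀^p z^p and ∫ W z^r.

Let y ≥ 0 solve the Lagrange equation w^q y^q = w₀^p y^p + W y^r. Take the tangent-line inequality
v^q ≤ (1 - q/p) + (q/p) v^p at v = z/y and multiply it by w₀^p y^p; do the same with r and W; add.
The result is `extremal_pointwise`, an equality at z = y. Integrating it shows that if the two
constraint energies of z do not exceed those of y, then neither does the q-energy
(`lintegral_le_of_energy_le`). The substitutions z(t) ↦ c z(δt) carry the general case to this one
(`lintegral_le_of_le`). Since y is invariant under permutations of the coordinates, its norms
‖wⱼy‖_r all agree, nothing is lost in the summation over j, and y attains the constant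
(`sharpConstant_le`).

To find y, let e = w^q y^q and let φ be the share of w₀^p y^p in e. Eliminating y from φ = w₀^p
w^(-q) y^(p-q) and 1 - φ = W w^(-q) y^(r-q) gives (r-q) log φ - (p-q) log(1-φ) = log(w₀^(p(r-q))
w^(q(p-r)) W^(-(p-q))), so φ is `logRatioInv` of an explicit function. Combining e, φe and (1-φ)e
with exponents 1/q, -γ/p and -(1-γ)/r cancels y and yields `extremalDensity`. This formula still
makes sense when q = p or q = r, where φ may reach 1 or 0 and y vanishes.

The density is a factor homogeneous of degree -d times a function of a log-homogeneous quantity.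
Polar coordinates therefore split its integral into the angular integral and a one-dimensional
integral (`lintegral_orthant_homogeneous`), which the substitution v = `logRatio` φ turns into beta
functions (`lintegral_logRatioInv`). The recurrences of the beta function split the energy E of y
into γE and (1-γ)E. -/

/-! ### Polar coordinates on the orthant -/

/-- Polar coordinates in the open quarter plane. -/
lemma lintegral_quarter_polar {F : ℝ × ℝ → ℝ≥0∞} (hF : Measurable F) :
    ∫⁻ a in Ioi (0 : ℝ), ∫⁻ b in Ioi (0 : ℝ), F (a, b) =
      ∫⁻ φ in Ioo (0 : ℝ) (Real.pi / 2), ∫⁻ ρ in Ioi (0 : ℝ),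
        ENNReal.ofReal ρ * F (ρ * Real.cos φ, ρ * Real.sin φ) := by
  have hQ : MeasurableSet (Ioi (0 : ℝ) ×ˢ Ioi (0 : ℝ)) := measurableSet_Ioi.prod measurableSet_Ioi
  have hT : MeasurableSet (Ioi (0 : ℝ) ×ˢ Ioo (0 : ℝ) (Real.pi / 2)) :=
    measurableSet_Ioi.prod measurableSet_Ioo
  have hG : Measurable fun x : ℝ × ℝ =>
      ENNReal.ofReal x.1 * F (x.1 * Real.cos x.2, x.1 * Real.sin x.2) := by fun_prop
  have h1 : ∫⁻ a in Ioi (0 : ℝ), ∫⁻ b in Ioi (0 : ℝ), F (a, b) =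
      ∫⁻ z, (Ioi (0 : ℝ) ×ˢ Ioi (0 : ℝ)).indicator F z := by
    rw [lintegral_indicator hQ, Measure.volume_eq_prod, ← Measure.prod_restrict,
      lintegral_prod _ hF.aemeasurable]
  have h2 : ∫⁻ φ in Ioo (0 : ℝ) (Real.pi / 2), ∫⁻ ρ in Ioi (0 : ℝ),
        ENNReal.ofReal ρ * F (ρ * Real.cos φ, ρ * Real.sin φ) =
      ∫⁻ x in Ioi (0 : ℝ) ×ˢ Ioo (0 : ℝ) (Real.pi / 2),
        ENNReal.ofReal x.1 * F (x.1 * Real.cos x.2, x.1 * Real.sin x.2) := by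
    rw [Measure.volume_eq_prod, ← Measure.prod_restrict,
      lintegral_prod_symm _ hG.aemeasurable]
  rw [h1, h2, ← lintegral_comp_polarCoord_symm, ← lintegral_indicator hT,
    ← lintegral_indicator polarCoord.open_target.measurableSet]
  congr 1
  ext ⟨ρ, φ⟩
  have hpi := Real.pi_pos
  by_cases hρ : 0 < ρ
  swap
  · rw [indicator_of_notMem, indicator_of_notMem] <;> simp [hρ]
  by_cases hφ : 0 < φ ∧ φ < Real.pi / 2
  · have hs : 0 < Real.sin φ := Real.sin_pos_of_pos_of_lt_pi hφ.1 (by linarith)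
    have hc : 0 < Real.cos φ := Real.cos_pos_of_mem_Ioo ⟨by linarith, hφ.2⟩
    rw [indicator_of_mem, indicator_of_mem, indicator_of_mem]
    · simp
    · simp [hρ, hφ]
    · simp only [polarCoord_symm_apply, mem_prod, mem_Ioi]
      exact ⟨mul_pos hρ hc, mul_pos hρ hs⟩
    · simp only [polarCoord_target, mem_prod, mem_Ioi, mem_Ioo]
      exact ⟨hρ, by linarith, by linarith⟩
  · rw [indicator_of_notMem (s := Ioi (0 : ℝ) ×ˢ Ioo (0 : ℝ) (Real.pi / 2)) (by simp [hρ]; grind)]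
    by_cases hT' : (ρ, φ) ∈ polarCoord.target
    · rw [indicator_of_mem hT', indicator_of_notMem, smul_zero]
      simp only [polarCoord_target, mem_prod, mem_Ioi, mem_Ioo] at hT'
      -- The polar chart has angles in (-π, π); there cos φ > 0 and sin φ > 0 together force 0 < φ <
      -- π/2.
      simp only [polarCoord_symm_apply, mem_prod, mem_Ioi, not_and, not_lt]
      intro hc
      have hc : 0 < Real.cos φ := (mul_pos_iff_of_pos_left hρ).1 hc
      refine mul_nonpos_of_nonneg_of_nonpos hρ.le (Real.sin_nonpos_of_nonpos_of_neg_pi_le ?_ hT'.2.1.le)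
      by_contra! h
      refine hc.not_ge (Real.cos_nonpos_of_pi_div_two_le_of_le ?_ (by linarith))
      grind
    · rw [indicator_of_notMem hT']

lemma sphereCoord_zero_succ (n : ℕ) (ω : Fin (n + 1) → ℝ) :
    sphereCoord (n + 2) ω 0 = Real.cos (ω 0) := by
  simp [sphereCoord]

lemma sphereCoord_succ_succ (n : ℕ) (ω : Fin (n + 1) → ℝ) (j : Fin (n + 1)) :
    sphereCoord (n + 2) ω j.succ =
      Real.sin (ω 0) * sphereCoord (n + 1) (fun i : Fin n => ω i.succ) j := by
  change ((∏ i : Fin (n + 1), if i.val < j.succ.val then Real.sin (ω i) else 1) *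
    if h : j.succ.val < n + 1 then Real.cos (ω ⟨j.succ.val, h⟩) else 1) = Real.sin (ω 0) *
    ((∏ i : Fin n, if i.val < j.val then Real.sin (ω i.succ) else 1) *
    if h : j.val < n then Real.cos (ω (Fin.succ ⟨j.val, h⟩)) else 1)
  rw [Fin.prod_univ_succ]
  simp [mul_assoc]

lemma angularJacobian_succ_succ (n : ℕ) (ω : Fin (n + 1) → ℝ) :
    angularJacobian (n + 2) ω =
      Real.sin (ω 0) ^ n * angularJacobian (n + 1) (fun i : Fin n => ω i.succ) := by
  change (∏ i : Fin (n + 1), Real.sin (ω i) ^ (n + 2 - 2 - i.val)) =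
    Real.sin (ω 0) ^ n * ∏ i : Fin n, Real.sin (ω i.succ) ^ (n + 1 - 2 - i.val)
  rw [Fin.prod_univ_succ]
  congr 1
  refine Finset.prod_congr rfl fun i _ => ?_
  congr 1
  simp
  omega

lemma sphereCoord_one (ω : Fin 0 → ℝ) (j : Fin 1) : sphereCoord 1 ω j = 1 := by
  simp [sphereCoord]

@[fun_prop]
lemma continuous_sphereCoord (d : ℕ) (j : Fin d) : Continuous fun ω => sphereCoord d ω j := by
  unfold sphereCoord
  refine Continuous.mul (continuous_finsetProd _ fun i _ => ?_) ?_
  · split_ifs <;> fun_prop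
  · split_ifs <;> fun_prop

@[fun_prop]
lemma continuous_angularJacobian (d : ℕ) : Continuous (angularJacobian d) := by
  unfold angularJacobian
  fun_prop

lemma sum_sphereCoord_sq (n : ℕ) (ω : Fin n → ℝ) :
    ∑ k, sphereCoord (n + 1) ω k ^ 2 = 1 := by
  induction n with
  | zero => simp [sphereCoord_one]
  | succ n ih =>
    rw [Fin.sum_univ_succ, sphereCoord_zero_succ]
    simp_rw [sphereCoord_succ_succ, mul_pow, ← Finset.mul_sum, ih]
    rw [mul_one, Real.cos_sq_add_sin_sq]

/-- Polar coordinates in the open orthant. -/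
theorem lintegral_orthant_polar (n : ℕ) {f : (Fin (n + 1) → ℝ) → ℝ≥0∞} (hf : Measurable f) :
    ∫⁻ t, f t ∂(Measure.pi fun _ : Fin (n + 1) => (volume : Measure ℝ).restrict (Ioi 0)) =
      ∫⁻ ω, (∫⁻ ρ in Ioi (0 : ℝ), ENNReal.ofReal (ρ ^ n * angularJacobian (n + 1) ω) *
        f (fun j => ρ * sphereCoord (n + 1) ω j))
        ∂(Measure.pi fun _ : Fin n => (volume : Measure ℝ).restrict (Ioo 0 (Real.pi / 2))) := by
  induction n with
  | zero =>
    -- In dimension one the angular space is a single point of mass one.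
    rw [Measure.pi_of_empty (α := Fin 0), lintegral_dirac]
    refine ((measurePreserving_funUnique ((volume : Measure ℝ).restrict (Ioi 0))
      (Fin 1)).symm.lintegral_comp hf).symm.trans ?_
    simp [sphereCoord_one, angularJacobian]
    rfl
  -- Apply the induction hypothesis to all coordinates but the first, obtaining a radius b. Then
  -- pass to plane polar coordinates in the pair (first coordinate, b), which gives (ρ cos φ, ρ sin
  -- φ). The factor ρ (ρ sin φ)^n supplies the new power of ρ and the new sine in the Jacobian.
  | succ n ih =>
    have hs : ∀ j, Measurable fun ω : Fin n → ℝ => sphereCoord (n + 1) ω j :=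
      fun j => (continuous_sphereCoord (n + 1) j).measurable
    have hJ : Measurable fun ω : Fin n → ℝ => angularJacobian (n + 1) ω :=
      (continuous_angularJacobian (n + 1)).measurable
    have hcons : ∀ {α : Type} [MeasurableSpace α] {k : ℕ} {u : α → ℝ} {v : α → Fin k → ℝ},
        Measurable u → Measurable v →
        Measurable fun x => (Fin.cons (u x) (v x) : Fin (k + 1) → ℝ) := by
      intro α _ k u v hu hv
      refine measurable_pi_iff.2 fun j => ?_
      refine Fin.cases ?_ (fun j => ?_) j
      · simpa using hu
      · simpa [Function.comp_def] using (measurable_pi_apply j).comp hv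
    have e1 := (measurePreserving_piFinSuccAbove (fun _ : Fin (n + 2) =>
      (volume : Measure ℝ).restrict (Ioi 0)) 0).symm
    have e2 := (measurePreserving_piFinSuccAbove (fun _ : Fin (n + 1) =>
      (volume : Measure ℝ).restrict (Ioo 0 (Real.pi / 2))) 0).symm
    rw [← e1.lintegral_comp hf, ← e2.lintegral_comp_emb (MeasurableEquiv.measurableEmbedding _)]
    have hf1 : Measurable fun x : ℝ × (Fin (n + 1) → ℝ) => f (Fin.cons x.1 x.2) :=
      hf.comp (hcons measurable_fst measurable_snd)
    have hg : Measurable fun x : (Fin n → ℝ) × (ℝ × ℝ) =>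
        ENNReal.ofReal (x.2.2 ^ n * angularJacobian (n + 1) x.1) *
          f (Fin.cons x.2.1 fun j => x.2.2 * sphereCoord (n + 1) x.1 j) := by
      refine Measurable.mul (by fun_prop) (hf.comp (hcons (by fun_prop) ?_))
      exact measurable_pi_iff.2 fun j => by fun_prop
    calc
      ∫⁻ x, f ((MeasurableEquiv.piFinSuccAbove (fun _ : Fin (n + 2) => ℝ) 0).symm x)
          ∂(((volume : Measure ℝ).restrict (Ioi 0)).prod
            (Measure.pi fun _ : Fin (n + 1) => (volume : Measure ℝ).restrict (Ioi 0)))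
        = ∫⁻ x : ℝ × (Fin (n + 1) → ℝ), f (Fin.cons x.1 x.2)
          ∂(((volume : Measure ℝ).restrict (Ioi 0)).prod
            (Measure.pi fun _ : Fin (n + 1) => (volume : Measure ℝ).restrict (Ioi 0))) := by
        refine lintegral_congr fun x => congrArg f ?_
        funext j
        exact Fin.cases rfl (fun j => rfl) j
      _ = ∫⁻ a in Ioi (0 : ℝ), ∫⁻ ω, (∫⁻ b in Ioi (0 : ℝ),
          ENNReal.ofReal (b ^ n * angularJacobian (n + 1) ω) *
          f (Fin.cons a fun j => b * sphereCoord (n + 1) ω j))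
          ∂(Measure.pi fun _ : Fin n => (volume : Measure ℝ).restrict (Ioo 0 (Real.pi / 2))) := by
        rw [lintegral_prod _ hf1.aemeasurable]
        refine lintegral_congr fun a => ?_
        exact ih (f := fun t => f (Fin.cons a t)) (hf.comp (hcons measurable_const measurable_id))
      _ = ∫⁻ ω, (∫⁻ a in Ioi (0 : ℝ), ∫⁻ b in Ioi (0 : ℝ),
          ENNReal.ofReal (b ^ n * angularJacobian (n + 1) ω) *
          f (Fin.cons a fun j => b * sphereCoord (n + 1) ω j))
          ∂(Measure.pi fun _ : Fin n => (volume : Measure ℝ).restrict (Ioo 0 (Real.pi / 2))) := by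
        rw [lintegral_lintegral_swap]
        refine Measurable.aemeasurable ?_
        refine Measurable.lintegral_prod_right'
          (f := fun (z : (ℝ × (Fin n → ℝ)) × ℝ) =>
            ENNReal.ofReal (z.2 ^ n * angularJacobian (n + 1) z.1.2) *
            f (Fin.cons z.1.1 fun j => z.2 * sphereCoord (n + 1) z.1.2 j)) ?_
        exact hg.comp (g := fun x : (Fin n → ℝ) × (ℝ × ℝ) =>
          ENNReal.ofReal (x.2.2 ^ n * angularJacobian (n + 1) x.1) *
          f (Fin.cons x.2.1 fun j => x.2.2 * sphereCoord (n + 1) x.1 j))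
          (f := fun z : (ℝ × (Fin n → ℝ)) × ℝ => (z.1.2, (z.1.1, z.2))) (by fun_prop)
      _ = ∫⁻ ω, (∫⁻ φ in Ioo (0 : ℝ) (Real.pi / 2), ∫⁻ ρ in Ioi (0 : ℝ),
          ENNReal.ofReal ρ * (ENNReal.ofReal ((ρ * Real.sin φ) ^ n * angularJacobian (n + 1) ω) *
          f (Fin.cons (ρ * Real.cos φ) fun j => (ρ * Real.sin φ) * sphereCoord (n + 1) ω j)))
          ∂(Measure.pi fun _ : Fin n => (volume : Measure ℝ).restrict (Ioo 0 (Real.pi / 2))) := by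
        refine lintegral_congr fun ω => ?_
        exact lintegral_quarter_polar (hg.comp (measurable_const.prodMk measurable_id) :
          Measurable fun x : ℝ × ℝ => ENNReal.ofReal (x.2 ^ n * angularJacobian (n + 1) ω) *
          f (Fin.cons x.1 fun j => x.2 * sphereCoord (n + 1) ω j))
      _ = ∫⁻ x : ℝ × (Fin n → ℝ), (∫⁻ ρ in Ioi (0 : ℝ),
          ENNReal.ofReal ρ * (ENNReal.ofReal ((ρ * Real.sin x.1) ^ n *
            angularJacobian (n + 1) x.2) *
          f (Fin.cons (ρ * Real.cos x.1) fun j => (ρ * Real.sin x.1) * sphereCoord (n + 1) x.2 j)))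
          ∂(((volume : Measure ℝ).restrict (Ioo 0 (Real.pi / 2))).prod
          (Measure.pi fun _ : Fin n => (volume : Measure ℝ).restrict (Ioo 0 (Real.pi / 2)))) := by
        rw [lintegral_prod_symm]
        refine Measurable.aemeasurable ?_
        refine Measurable.lintegral_prod_right' (f := fun (z : (ℝ × (Fin n → ℝ)) × ℝ) =>
          ENNReal.ofReal z.2 * (ENNReal.ofReal ((z.2 * Real.sin z.1.1) ^ n *
            angularJacobian (n + 1) z.1.2) *
          f (Fin.cons (z.2 * Real.cos z.1.1)
            fun j => (z.2 * Real.sin z.1.1) * sphereCoord (n + 1) z.1.2 j))) ?_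
        refine Measurable.mul (by fun_prop) ?_
        exact hg.comp (g := fun x : (Fin n → ℝ) × (ℝ × ℝ) =>
          ENNReal.ofReal (x.2.2 ^ n * angularJacobian (n + 1) x.1) *
          f (Fin.cons x.2.1 fun j => x.2.2 * sphereCoord (n + 1) x.1 j))
          (f := fun z : (ℝ × (Fin n → ℝ)) × ℝ =>
            (z.1.2, (z.2 * Real.cos z.1.1, z.2 * Real.sin z.1.1))) (by fun_prop)
      _ = _ := by
        refine lintegral_congr fun x => ?_
        refine setLIntegral_congr_fun measurableSet_Ioi fun ρ hρ => ?_
        have hρ : 0 < ρ := hρ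
        have hJ' := angularJacobian_succ_succ n ((MeasurableEquiv.piFinSuccAbove
          (fun _ => ℝ) 0).symm x)
        have h0 := sphereCoord_zero_succ n ((MeasurableEquiv.piFinSuccAbove
          (fun _ => ℝ) 0).symm x)
        have h1 := sphereCoord_succ_succ n ((MeasurableEquiv.piFinSuccAbove
          (fun _ => ℝ) 0).symm x)
        have hx0 : (MeasurableEquiv.piFinSuccAbove (fun _ : Fin (n + 1) => ℝ) 0).symm x 0 = x.1 :=
          rfl
        have hx1 : ∀ i : Fin n,
            (MeasurableEquiv.piFinSuccAbove (fun _ : Fin (n + 1) => ℝ) 0).symm x i.succ = x.2 i :=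
          fun _ => rfl
        simp only [hx0, hx1] at hJ' h0 h1
        rw [hJ', ← mul_assoc, ← ENNReal.ofReal_mul hρ.le]
        congr 2
        · ring
        · funext j
          refine Fin.cases ?_ (fun j => ?_) j
          · rw [h0]; rfl
          · rw [h1, ← mul_assoc]; rfl

/-! ### The share equation and its inverse -/

/-- The admissible triples, described by inequalities. -/
lemma admissible {p q r : ℝ} (h : (p, q, r) ∈ P ∪ P₁ ∪ P₂) :
    1 ≤ q ∧ q ≤ p ∧ q ≤ r ∧ 0 < (r - q) + (p - q) := by
  simp only [P, P₁, P₂, mem_union, mem_ofPred_eq] at h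
  grind

/-- The function `(r - q) log φ - (p - q) log (1 - φ)` on `(0, 1)`. -/
def logRatio (p q r φ : ℝ) : ℝ := (r - q) * Real.log φ - (p - q) * Real.log (1 - φ)

lemma strictMonoOn_logRatio {p q r : ℝ} (hp : q ≤ p) (hr : q ≤ r) (h : 0 < (r - q) + (p - q)) :
    StrictMonoOn (logRatio p q r) (Ioo 0 1) := by
  intro a ha b hb hab
  have h1 : Real.log a < Real.log b := Real.log_lt_log ha.1 hab
  have h2 : Real.log (1 - b) < Real.log (1 - a) :=
    Real.log_lt_log (by linarith [hb.2]) (by linarith)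
  unfold logRatio
  rcases hp.lt_or_eq with hp | rfl
  · nlinarith [mul_pos (sub_pos.2 hp) (sub_pos.2 h2),
      mul_nonneg (sub_nonneg.2 hr) (sub_pos.2 h1).le]
  · nlinarith [mul_pos (show 0 < r - q by linarith) (sub_pos.2 h1)]

lemma hasDerivAt_logRatio (p q r : ℝ) {φ : ℝ} (hφ : φ ∈ Ioo (0 : ℝ) 1) :
    HasDerivAt (logRatio p q r) ((r - q) / φ + (p - q) / (1 - φ)) φ := by
  have h1 := (Real.hasDerivAt_log hφ.1.ne').const_mul (r - q)
  have h2 := (((hasDerivAt_id φ).const_sub 1).log (sub_pos.2 hφ.2).ne').const_mul (p - q)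
  refine (h1.sub h2).congr_deriv ?_
  simp only [id]
  ring

/-- The monotone extension to `ℝ` of the inverse of `logRatio p q r`. -/
def logRatioInv (p q r v : ℝ) : ℝ := sSup {φ | φ = 0 ∨ φ ∈ Ioo 0 1 ∧ logRatio p q r φ ≤ v}

section
variable {p q r : ℝ}

lemma bddAbove_logRatioInv (v : ℝ) :
    BddAbove {φ | φ = 0 ∨ φ ∈ Ioo 0 1 ∧ logRatio p q r φ ≤ v} :=
  ⟨1, by rintro φ (rfl | h); exacts [zero_le_one, h.1.2.le]⟩

/-- Monotonicity on all of ℝ is what later makes the extremal function measurable. -/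
lemma monotone_logRatioInv : Monotone (logRatioInv p q r) := fun _ v h =>
  csSup_le_csSup (bddAbove_logRatioInv v) ⟨0, Or.inl rfl⟩
    fun _ hφ => hφ.imp id fun hφ => ⟨hφ.1, hφ.2.trans h⟩

lemma logRatioInv_nonneg (v : ℝ) : 0 ≤ logRatioInv p q r v :=
  le_csSup (bddAbove_logRatioInv v) (Or.inl rfl)

lemma logRatioInv_le_one (v : ℝ) : logRatioInv p q r v ≤ 1 :=
  csSup_le ⟨0, Or.inl rfl⟩ (by rintro φ (rfl | h); exacts [zero_le_one, h.1.2.le])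

lemma le_logRatioInv {φ v : ℝ} (hφ : φ ∈ Ioo (0 : ℝ) 1) (h : logRatio p q r φ ≤ v) :
    φ ≤ logRatioInv p q r v :=
  le_csSup (bddAbove_logRatioInv v) (Or.inr ⟨hφ, h⟩)

lemma logRatio_le_of_lt (hp : q ≤ p) (hr : q ≤ r) (h : 0 < (r - q) + (p - q)) {φ v : ℝ}
    (hφ : φ ∈ Ioo (0 : ℝ) 1) (hv : φ < logRatioInv p q r v) : logRatio p q r φ ≤ v := by
  obtain ⟨ψ, hψ, hlt⟩ := exists_lt_of_lt_csSup ⟨(0 : ℝ), Or.inl rfl⟩ (show φ < sSup _ from hv)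
  rcases hψ with rfl | hψ
  · exact absurd hlt hφ.1.not_gt
  · exact ((strictMonoOn_logRatio hp hr h) hφ hψ.1 hlt).le.trans hψ.2

lemma logRatioInv_logRatio (hp : q ≤ p) (hr : q ≤ r) (h : 0 < (r - q) + (p - q)) {φ : ℝ}
    (hφ : φ ∈ Ioo (0 : ℝ) 1) : logRatioInv p q r (logRatio p q r φ) = φ := by
  refine le_antisymm (csSup_le ⟨0, Or.inl rfl⟩ ?_) (le_logRatioInv hφ le_rfl)
  rintro ψ (rfl | hψ)
  · exact hφ.1.le
  · exact ((strictMonoOn_logRatio hp hr h).le_iff_le hψ.1 hφ).1 hψ.2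

/-- To the left of the supremum `logRatio` is at most v, and to the right it exceeds v; continuity
at the supremum gives equality. -/
lemma logRatio_logRatioInv (hp : q ≤ p) (hr : q ≤ r) (h : 0 < (r - q) + (p - q)) {v : ℝ}
    (hv : logRatioInv p q r v ∈ Ioo (0 : ℝ) 1) : logRatio p q r (logRatioInv p q r v) = v := by
  set φ := logRatioInv p q r v with hφ
  have hc : ContinuousAt (logRatio p q r) φ := (hasDerivAt_logRatio p q r hv).continuousAt
  refine le_antisymm ?_ ?_
  · refine le_of_tendsto (hc.mono_left nhdsWithin_le_nhds : Filter.Tendsto _ (nhdsWithin φ (Iio φ)) _) ?_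
    filter_upwards [Ioo_mem_nhdsLT hv.1] with ψ hψ
    exact logRatio_le_of_lt hp hr h ⟨hψ.1, hψ.2.trans hv.2⟩ hψ.2
  · refine ge_of_tendsto (hc.mono_left nhdsWithin_le_nhds : Filter.Tendsto _ (nhdsWithin φ (Ioi φ)) _) ?_
    filter_upwards [Ioo_mem_nhdsGT hv.2] with ψ hψ
    by_contra! hlt
    exact hψ.1.not_ge (le_logRatioInv ⟨hv.1.trans hψ.1, hψ.2⟩ hlt.le)

open Filter Topology in
-- For q < r the function tends to -∞ at 0, so every v is exceeded from below near 0. Only for q = r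
-- is the limit at 0 finite, namely 0, and then values v ≤ 0 can be missed.
lemma eq_of_logRatioInv_eq_zero (hr : q ≤ r)
    {v : ℝ} (hv : logRatioInv p q r v = 0) : q = r ∧ v ≤ 0 := by
  have hlt : ∀ φ ∈ Ioo (0 : ℝ) 1, v < logRatio p q r φ := fun φ hφ => by
    by_contra! hle
    exact hφ.1.not_ge (hv ▸ le_logRatioInv hφ hle)
  have hmem : ∀ᶠ φ in 𝓝[>] (0 : ℝ), φ ∈ Ioo (0 : ℝ) 1 := Ioo_mem_nhdsGT zero_lt_one
  have hlim : Tendsto (fun φ : ℝ => (p - q) * Real.log (1 - φ)) (𝓝[>] 0) (𝓝 0) := by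
    have : ContinuousAt (fun φ : ℝ => (p - q) * Real.log (1 - φ)) 0 := by
      refine continuousAt_const.mul (ContinuousAt.log (by fun_prop) (by simp))
    simpa using this.tendsto.mono_left (nhdsWithin_le_nhds (s := Ioi 0))
  rcases hr.lt_or_eq with hr | rfl
  · have h1 : Tendsto (logRatio p q r) (𝓝[>] 0) atBot := by
      have := (Real.tendsto_log_nhdsGT_zero.const_mul_atBot (sub_pos.2 hr)).atBot_add hlim.neg
      refine this.congr fun φ => ?_
      simp [logRatio, sub_eq_add_neg]
    obtain ⟨φ, h2, h3⟩ := ((h1.eventually (eventually_lt_atBot v)).and hmem).exists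
    exact absurd (hlt φ h3) h2.not_gt
  · refine ⟨rfl, ?_⟩
    have := hlim.neg
    rw [neg_zero] at this
    refine ge_of_tendsto this ?_
    filter_upwards [hmem] with φ hφ
    simpa [logRatio] using (hlt φ hφ).le

open Filter Topology in
-- The mirror image at the endpoint 1: the function tends to +∞ there if q < p, and to 0 if q = p.
lemma eq_of_logRatioInv_eq_one (hp : q ≤ p) (hr : q ≤ r) (h : 0 < (r - q) + (p - q))
    {v : ℝ} (hv : logRatioInv p q r v = 1) : q = p ∧ 0 ≤ v := by
  have hlt : ∀ φ ∈ Ioo (0 : ℝ) 1, logRatio p q r φ ≤ v := fun φ hφ =>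
    logRatio_le_of_lt hp hr h hφ (hv ▸ hφ.2)
  have hmem : ∀ᶠ φ in 𝓝[<] (1 : ℝ), φ ∈ Ioo (0 : ℝ) 1 := Ioo_mem_nhdsLT zero_lt_one
  have hlim : Tendsto (fun φ : ℝ => (r - q) * Real.log φ) (𝓝[<] 1) (𝓝 0) := by
    have : ContinuousAt (fun φ : ℝ => (r - q) * Real.log φ) 1 := by
      refine continuousAt_const.mul (ContinuousAt.log (by fun_prop) (by simp))
    simpa using this.tendsto.mono_left (nhdsWithin_le_nhds (s := Iio 1))
  rcases hp.lt_or_eq with hp | rfl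
  · have h0 : Tendsto (fun φ : ℝ => 1 - φ) (𝓝[<] 1) (𝓝[>] 0) := by
      refine tendsto_nhdsWithin_iff.2 ⟨?_, ?_⟩
      · have : ContinuousAt (fun φ : ℝ => 1 - φ) 1 := by fun_prop
        simpa using this.tendsto.mono_left (nhdsWithin_le_nhds (s := Iio 1))
      · filter_upwards [hmem] with φ hφ using sub_pos.2 hφ.2
    have h1 : Tendsto (logRatio p q r) (𝓝[<] 1) atTop := by
      have := tendsto_neg_atBot_atTop.comp
        ((Real.tendsto_log_nhdsGT_zero.comp h0).const_mul_atBot (sub_pos.2 hp))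
      have := hlim.add_atTop this
      refine this.congr fun φ => ?_
      simp [logRatio, sub_eq_add_neg]
    obtain ⟨φ, h2, h3⟩ := ((h1.eventually (eventually_gt_atTop v)).and hmem).exists
    exact absurd (hlt φ h3) h2.not_ge
  · refine ⟨rfl, ?_⟩
    refine le_of_tendsto hlim ?_
    filter_upwards [hmem] with φ hφ
    simpa [logRatio] using (hlt φ hφ)

end

/-! ### The tangent-line inequality and the pointwise extremal problem -/

/-- Weighted AM–GM for 1 and v^p with weights 1 - q/p and q/p. -/
lemma rpow_le_convex_comb {p q v : ℝ} (hq : 0 < q) (hp : q ≤ p) (hv : 0 ≤ v) :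
    v ^ q ≤ (1 - q / p) + q / p * v ^ p := by
  have hp0 : 0 < p := hq.trans_le hp
  have h1 : 0 ≤ 1 - q / p := sub_nonneg.2 ((div_le_one hp0).2 hp)
  have := Real.geom_mean_le_arith_mean2_weighted h1 (div_pos hq hp0).le zero_le_one
    (Real.rpow_nonneg hv p) (by ring)
  rwa [Real.one_rpow, one_mul, mul_one, ← Real.rpow_mul hv, mul_div_cancel₀ _ hp0.ne'] at this

/-- The tangent-line inequality between powers with a homogeneous normalisation. -/
lemma mul_rpow_le_convex_comb {p q y z A : ℝ} (hq : 0 < q) (hp : q ≤ p) (hy : 0 < y) (hz : 0 ≤ z)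
    (hA : 0 ≤ A) : A * y ^ (p - q) * z ^ q ≤ (1 - q / p) * (A * y ^ p) + q / p * (A * z ^ p) := by
  have h := rpow_le_convex_comb hq hp (div_nonneg hz hy.le)
  rw [Real.div_rpow hz hy.le, Real.div_rpow hz hy.le] at h
  have hyp := Real.rpow_pos_of_pos hy p
  have hyq := Real.rpow_pos_of_pos hy q
  have := mul_le_mul_of_nonneg_left h (mul_nonneg hA hyp.le)
  rw [Real.rpow_sub hy]
  calc _ = A * y ^ p * (z ^ q / y ^ q) := by field_simp
    _ ≤ _ := this
    _ = _ := by field_simp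

/-- The energy density of the extremal function at a point where the logarithms of
`w`, `w₀` and `W` are `lw`, `lw₀` and `lW`. -/
def extremalDensity (p q r γ s lw lw₀ lW : ℝ) : ℝ :=
  Real.exp (s * (lw - γ * lw₀ - (1 - γ) / r * lW)) *
    (logRatioInv p q r (p * (r - q) * lw₀ + q * (p - r) * lw - (p - q) * lW) ^ (s * γ / p) *
    (1 - logRatioInv p q r (p * (r - q) * lw₀ + q * (p - r) * lw - (p - q) * lW)) ^
      (s * (1 - γ) / r))

lemma extremalDensity_nonneg (p q r γ s lw lw₀ lW : ℝ) :
    0 ≤ extremalDensity p q r γ s lw lw₀ lW :=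
  mul_nonneg (Real.exp_pos _).le (mul_nonneg (Real.rpow_nonneg (logRatioInv_nonneg _) _)
    (Real.rpow_nonneg (sub_nonneg.2 (logRatioInv_le_one _)) _))

/-- The value of the extremal function. -/
def extremalValue (p q r γ s lw lw₀ lW : ℝ) : ℝ :=
  extremalDensity p q r γ s lw lw₀ lW ^ (1 / q) * Real.exp (-lw)

section
variable {p q r γ s : ℝ}

lemma extremalValue_nonneg (lw lw₀ lW : ℝ) : 0 ≤ extremalValue p q r γ s lw lw₀ lW :=
  mul_nonneg (Real.rpow_nonneg (extremalDensity_nonneg ..) _) (Real.exp_pos _).le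

lemma exp_mul_extremalValue_rpow (hq : 0 < q) (lw lw₀ lW : ℝ) :
    Real.exp (q * lw) * extremalValue p q r γ s lw lw₀ lW ^ q =
      extremalDensity p q r γ s lw lw₀ lW := by
  rw [extremalValue, Real.mul_rpow (Real.rpow_nonneg (extremalDensity_nonneg ..) _)
    (Real.exp_pos _).le, ← Real.rpow_mul (extremalDensity_nonneg ..), one_div_mul_cancel hq.ne',
    Real.rpow_one, ← Real.exp_mul, mul_left_comm, ← Real.exp_add]
  simp [show q * lw + -(lw * q) = 0 by ring]

/-- Both exponents in the density are positive, so it vanishes exactly where the share is 0 or 1. -/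
lemma extremal_dichotomy (hp0 : 0 < p) (hr0 : 0 < r) (hγ : γ ∈ Ioo (0 : ℝ) 1) (hs : 0 < s)
    (lw lw₀ lW : ℝ) :
    (logRatioInv p q r (p * (r - q) * lw₀ + q * (p - r) * lw - (p - q) * lW) ∈ Ioo (0 : ℝ) 1 ∧
      0 < extremalDensity p q r γ s lw lw₀ lW) ∨
    ((logRatioInv p q r (p * (r - q) * lw₀ + q * (p - r) * lw - (p - q) * lW) = 0 ∨
      logRatioInv p q r (p * (r - q) * lw₀ + q * (p - r) * lw - (p - q) * lW) = 1) ∧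
      extremalDensity p q r γ s lw lw₀ lW = 0) := by
  have ha : s * γ / p ≠ 0 := (div_pos (mul_pos hs hγ.1) hp0).ne'
  have hb : s * (1 - γ) / r ≠ 0 := (div_pos (mul_pos hs (sub_pos.2 hγ.2)) hr0).ne'
  unfold extremalDensity
  set v := p * (r - q) * lw₀ + q * (p - r) * lw - (p - q) * lW
  rcases (logRatioInv_nonneg (p := p) (q := q) (r := r) v).eq_or_lt with h0 | h0
  · exact Or.inr ⟨Or.inl h0.symm, by simp [← h0, Real.zero_rpow ha]⟩
  rcases (logRatioInv_le_one (p := p) (q := q) (r := r) v).eq_or_lt with h1 | h1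
  · exact Or.inr ⟨Or.inr h1, by simp [h1, Real.zero_rpow hb]⟩
  · exact Or.inl ⟨⟨h0, h1⟩, mul_pos (Real.exp_pos _) (mul_pos (Real.rpow_pos_of_pos h0 _)
      (Real.rpow_pos_of_pos (sub_pos.2 h1) _))⟩

lemma log_extremalDensity {lw lw₀ lW : ℝ}
    (h : logRatioInv p q r (p * (r - q) * lw₀ + q * (p - r) * lw - (p - q) * lW) ∈
      Ioo (0 : ℝ) 1) :
    Real.log (extremalDensity p q r γ s lw lw₀ lW) =
      s * (lw - γ * lw₀ - (1 - γ) / r * lW) + (s * γ / p *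
        Real.log (logRatioInv p q r (p * (r - q) * lw₀ + q * (p - r) * lw - (p - q) * lW)) +
      s * (1 - γ) / r * Real.log (1 - logRatioInv p q r
        (p * (r - q) * lw₀ + q * (p - r) * lw - (p - q) * lW))) := by
  unfold extremalDensity
  set φ := logRatioInv p q r (p * (r - q) * lw₀ + q * (p - r) * lw - (p - q) * lW)
  have h1 := Real.rpow_pos_of_pos h.1 (s * γ / p)
  have h2 := Real.rpow_pos_of_pos (sub_pos.2 h.2) (s * (1 - γ) / r)
  rw [Real.log_mul (Real.exp_pos _).ne' (mul_pos h1 h2).ne', Real.log_mul h1.ne' h2.ne',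
    Real.log_exp, Real.log_rpow h.1, Real.log_rpow (sub_pos.2 h.2)]

variable (hq : 0 < q) (hp : q ≤ p) (hr : q ≤ r) (h : 0 < (r - q) + (p - q))
  (hγ : γ ∈ Ioo (0 : ℝ) 1) (hs : 0 < s) (hs' : s * (1 / q - γ / p - (1 - γ) / r) = 1)
include hq hp hr h hγ hs hs'

/-- This and its companion for the exponent r confirm that the share φ splits the density as
intended. Where the density is positive, taking logarithms leaves a linear identity in log φ and
log(1-φ), a combination of the share equation and the normalisation of s. -/
lemma exp_mul_extremalValue_rpow_left (lw lw₀ lW : ℝ) :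
    Real.exp (p * lw₀) * extremalValue p q r γ s lw lw₀ lW ^ p =
      logRatioInv p q r (p * (r - q) * lw₀ + q * (p - r) * lw - (p - q) * lW) *
        extremalDensity p q r γ s lw lw₀ lW := by
  have hp0 := hq.trans_le hp
  have hr0 := hq.trans_le hr
  rcases extremal_dichotomy (q := q) hp0 hr0 hγ hs lw lw₀ lW with ⟨hφ, he⟩ | ⟨-, he⟩
  swap
  · rw [extremalValue, he, Real.zero_rpow (by positivity)]
    simp [hp0.ne']
  have hlog := log_extremalDensity (γ := γ) (s := s) hφ
  have hG := logRatio_logRatioInv hp hr h hφ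
  rw [logRatio] at hG
  set φ := logRatioInv p q r (p * (r - q) * lw₀ + q * (p - r) * lw - (p - q) * lW)
  set e := extremalDensity p q r γ s lw lw₀ lW
  have hy : 0 < extremalValue p q r γ s lw lw₀ lW :=
    mul_pos (Real.rpow_pos_of_pos he _) (Real.exp_pos _)
  have hly : Real.log (extremalValue p q r γ s lw lw₀ lW) = 1 / q * Real.log e - lw := by
    rw [extremalValue, Real.log_mul (Real.rpow_pos_of_pos he _).ne' (Real.exp_pos _).ne',
      Real.log_exp, Real.log_rpow he]
    ring
  refine Real.log_injOn_pos (mul_pos (Real.exp_pos _) (Real.rpow_pos_of_pos hy _))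
    (mul_pos hφ.1 he) ?_
  rw [Real.log_mul (Real.exp_pos _).ne' (Real.rpow_pos_of_pos hy _).ne',
    Real.log_mul hφ.1.ne' he.ne', Real.log_exp, Real.log_rpow hy, hly, hlog]
  set lφ := Real.log φ
  set lψ := Real.log (1 - φ)
  linear_combination (norm := (field_simp; ring)) -(s * (1 - γ) / (q * r)) * hG +
    (lφ - p * lw₀ + p * lw) * hs'

lemma exp_mul_extremalValue_rpow_right (lw lw₀ lW : ℝ) :
    Real.exp lW * extremalValue p q r γ s lw lw₀ lW ^ r =
      (1 - logRatioInv p q r (p * (r - q) * lw₀ + q * (p - r) * lw - (p - q) * lW)) *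
        extremalDensity p q r γ s lw lw₀ lW := by
  have hp0 := hq.trans_le hp
  have hr0 := hq.trans_le hr
  rcases extremal_dichotomy (q := q) hp0 hr0 hγ hs lw lw₀ lW with ⟨hφ, he⟩ | ⟨-, he⟩
  swap
  · rw [extremalValue, he, Real.zero_rpow (by positivity)]
    simp [hr0.ne']
  have hlog := log_extremalDensity (γ := γ) (s := s) hφ
  have hG := logRatio_logRatioInv hp hr h hφ
  rw [logRatio] at hG
  set φ := logRatioInv p q r (p * (r - q) * lw₀ + q * (p - r) * lw - (p - q) * lW)
  set e := extremalDensity p q r γ s lw lw₀ lW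
  have hφ' : 0 < 1 - φ := sub_pos.2 hφ.2
  have hy : 0 < extremalValue p q r γ s lw lw₀ lW :=
    mul_pos (Real.rpow_pos_of_pos he _) (Real.exp_pos _)
  have hly : Real.log (extremalValue p q r γ s lw lw₀ lW) = 1 / q * Real.log e - lw := by
    rw [extremalValue, Real.log_mul (Real.rpow_pos_of_pos he _).ne' (Real.exp_pos _).ne',
      Real.log_exp, Real.log_rpow he]
    ring
  refine Real.log_injOn_pos (mul_pos (Real.exp_pos _) (Real.rpow_pos_of_pos hy _))
    (mul_pos hφ' he) ?_
  rw [Real.log_mul (Real.exp_pos _).ne' (Real.rpow_pos_of_pos hy _).ne',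
    Real.log_mul hφ'.ne' he.ne', Real.log_exp, Real.log_rpow hy, hly, hlog]
  set lφ := Real.log φ
  set lψ := Real.log (1 - φ)
  linear_combination (norm := (field_simp; ring)) (s * γ / (q * p)) * hG +
    (lψ - lW + r * lw) * hs'

/-- The pointwise inequality that expresses the optimality of the extremal function. -/
lemma extremal_pointwise (lw lw₀ lW : ℝ) {z : ℝ} (hz : 0 ≤ z) :
    Real.exp (q * lw) * z ^ q ≤
      (1 - q / p) * (Real.exp (p * lw₀) * extremalValue p q r γ s lw lw₀ lW ^ p) +
      (1 - q / r) * (Real.exp lW * extremalValue p q r γ s lw lw₀ lW ^ r) +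
      (q / p * (Real.exp (p * lw₀) * z ^ p) + q / r * (Real.exp lW * z ^ r)) := by
  have hp0 := hq.trans_le hp
  have hr0 := hq.trans_le hr
  have hl := exp_mul_extremalValue_rpow_left hq hp hr h hγ hs hs' lw lw₀ lW
  have hR := exp_mul_extremalValue_rpow_right hq hp hr h hγ hs hs' lw lw₀ lW
  have hm := exp_mul_extremalValue_rpow (p := p) (r := r) (γ := γ) (s := s) hq lw lw₀ lW
  rcases extremal_dichotomy (q := q) hp0 hr0 hγ hs lw lw₀ lW with ⟨hφ, he⟩ | ⟨h01, he⟩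
  · have hy : 0 < extremalValue p q r γ s lw lw₀ lW :=
      mul_pos (Real.rpow_pos_of_pos he _) (Real.exp_pos _)
    have h1 := mul_rpow_le_convex_comb hq hp hy hz (Real.exp_pos (p * lw₀)).le
    have h2 := mul_rpow_le_convex_comb hq hr hy hz (Real.exp_pos lW).le
    set y := extremalValue p q r γ s lw lw₀ lW
    have hyq := Real.rpow_pos_of_pos hy q
    -- The Lagrange equation divided by y^q and multiplied by z^q.
    have hsum : Real.exp (q * lw) * z ^ q =
        Real.exp (p * lw₀) * y ^ (p - q) * z ^ q + Real.exp lW * y ^ (r - q) * z ^ q := by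
      rw [Real.rpow_sub hy, Real.rpow_sub hy, ← add_mul]
      congr 1
      field_simp
      linarith
    linarith
  · have hzp := Real.rpow_nonneg hz p
    have hzr := Real.rpow_nonneg hz r
    have hzq := Real.rpow_nonneg hz q
    have hqp : 0 ≤ q / p := (div_pos hq hp0).le
    have hqr : 0 ≤ q / r := (div_pos hq hr0).le
    rw [hl, hR, he, mul_zero, mul_zero, mul_zero, mul_zero, zero_add, zero_add]
    rcases h01 with h0 | h1
    -- Here q = r and y = 0, and the sign of the argument says w^q ≤ W; the term W z^r, whose
    -- coefficient is now 1, suffices.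
    · obtain ⟨rfl, hv⟩ := eq_of_logRatioInv_eq_zero hr h0
      have hle : q * lw ≤ lW := by
        have : (p - q) * (q * lw - lW) ≤ 0 := by linarith
        by_contra! hlt
        exact this.not_gt (mul_pos (by linarith) (sub_pos.2 hlt))
      rw [div_self hq.ne', one_mul]
      have := mul_le_mul_of_nonneg_right (Real.exp_le_exp.2 hle) hzq
      have := mul_nonneg hqp (mul_nonneg (Real.exp_pos (p * lw₀)).le hzp)
      linarith
    -- Here q = p and y = 0, and the sign of the argument says w^q ≤ w₀^p.
    · obtain ⟨rfl, hv⟩ := eq_of_logRatioInv_eq_one hp hr h h1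
      have hle : q * lw ≤ q * lw₀ := by
        have : 0 ≤ (r - q) * (q * lw₀ - q * lw) := by linarith
        by_contra! hlt
        exact this.not_gt (mul_neg_of_pos_of_neg (by linarith) (sub_neg.2 hlt))
      rw [div_self hq.ne', one_mul]
      have := mul_le_mul_of_nonneg_right (Real.exp_le_exp.2 hle) hzq
      have := mul_nonneg hqr (mul_nonneg (Real.exp_pos lW).le hzr)
      linarith

end

/-! ### Null boundaries, positivity, and separation of the radial variable -/

/-- The boundary of the orthant is null. On the open orthant all coordinates are positive, so the
weights may be handled through logarithms. -/
lemma orthantMeasure_eq_pi (d : ℕ) :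
    orthantMeasure d = Measure.pi fun _ : Fin d => (volume : Measure ℝ).restrict (Ioi 0) := by
  rw [← Measure.restrict_pi_pi, ← volume_pi, orthantMeasure]
  refine Measure.restrict_congr_set ?_
  have := (Measure.univ_pi_Ioi_ae_eq_Ici (μ := fun _ : Fin d => (volume : Measure ℝ))
    (f := fun _ => 0)).symm
  rwa [show (Ici fun _ => 0 : Set (Fin d → ℝ)) = {t | ∀ i, 0 ≤ t i} by ext t; simp [Pi.le_def],
    ← volume_pi] at this

lemma ae_orthant_pos (d : ℕ) : ∀ᵐ t ∂(orthantMeasure d), ∀ i, 0 < t i := by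
  rw [orthantMeasure_eq_pi, ← Measure.restrict_pi_pi]
  filter_upwards [ae_restrict_mem (MeasurableSet.univ_pi fun _ => measurableSet_Ioi)] with t ht i
  exact ht i trivial

lemma restrict_angularCube (n : ℕ) :
    (volume : Measure (Fin n → ℝ)).restrict (angularCube (n + 1)) =
      Measure.pi fun _ : Fin n => (volume : Measure ℝ).restrict (Ioo 0 (Real.pi / 2)) := by
  rw [← Measure.restrict_pi_pi, ← volume_pi]
  refine Measure.restrict_congr_set ?_
  have := (Measure.univ_pi_Ioo_ae_eq_Icc (μ := fun _ : Fin n => (volume : Measure ℝ))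
    (f := fun _ => 0) (g := fun _ => Real.pi / 2)).symm
  rwa [show (Icc (fun _ => 0) fun _ => Real.pi / 2 : Set (Fin n → ℝ)) = angularCube (n + 1) by
    ext t; simp [angularCube, Pi.le_def, forall_and], ← volume_pi] at this

lemma ae_angle_mem (n : ℕ) : ∀ᵐ ω ∂(Measure.pi fun _ : Fin n =>
    (volume : Measure ℝ).restrict (Ioo 0 (Real.pi / 2))), ∀ i, ω i ∈ Ioo 0 (Real.pi / 2) := by
  rw [← Measure.restrict_pi_pi]
  filter_upwards [ae_restrict_mem (MeasurableSet.univ_pi fun _ => measurableSet_Ioo)] with t ht i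
  exact ht i trivial

lemma sphereCoord_pos {n : ℕ} {ω : Fin n → ℝ} (hω : ∀ i, ω i ∈ Ioo 0 (Real.pi / 2))
    (j : Fin (n + 1)) : 0 < sphereCoord (n + 1) ω j := by
  have hpi := Real.pi_pos
  refine mul_pos (Finset.prod_pos fun i _ => ?_) ?_
  · split_ifs
    · exact Real.sin_pos_of_pos_of_lt_pi (hω i).1 (by linarith [(hω i).2])
    · exact one_pos
  · split_ifs with h
    · exact Real.cos_pos_of_mem_Ioo ⟨by linarith [(hω ⟨j.val, h⟩).1], (hω ⟨j.val, h⟩).2⟩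
    · exact one_pos

lemma sphereCoord_nonneg {n : ℕ} {ω : Fin n → ℝ} (hω : ω ∈ angularCube (n + 1))
    (j : Fin (n + 1)) : 0 ≤ sphereCoord (n + 1) ω j := by
  have hpi := Real.pi_pos
  refine mul_nonneg (Finset.prod_nonneg fun i _ => ?_) ?_
  · split_ifs
    · exact Real.sin_nonneg_of_nonneg_of_le_pi (hω i).1 (by linarith [(hω i).2])
    · exact zero_le_one
  · split_ifs with h
    · exact Real.cos_nonneg_of_mem_Icc
        ⟨by linarith [(hω ⟨j.val, h⟩).1], (hω ⟨j.val, h⟩).2⟩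
    · exact zero_le_one

lemma angularJacobian_pos {n : ℕ} {ω : Fin n → ℝ} (hω : ∀ i, ω i ∈ Ioo 0 (Real.pi / 2)) :
    0 < angularJacobian (n + 1) ω := by
  have hpi := Real.pi_pos
  exact Finset.prod_pos fun i _ =>
    pow_pos (Real.sin_pos_of_pos_of_lt_pi (hω i).1 (by linarith [(hω i).2])) _

/-- Substitution v = κ log ρ + c. The shift c disappears, which is why the radial integral does not
depend on the angles. -/
lemma lintegral_comp_log {κ : ℝ} (hκ : κ ≠ 0) (c : ℝ) (F : ℝ → ℝ≥0∞) :
    ∫⁻ ρ in Ioi (0 : ℝ), ENNReal.ofReal ρ⁻¹ * F (κ * Real.log ρ + c) =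
      ENNReal.ofReal |κ|⁻¹ * ∫⁻ v, F v := by
  have himg : (fun σ : ℝ => Real.exp ((σ - c) / κ)) '' univ = Ioi 0 := by
    ext ρ
    simp only [image_univ, mem_range, mem_Ioi]
    constructor
    · rintro ⟨σ, rfl⟩
      exact Real.exp_pos _
    · intro hρ
      refine ⟨κ * Real.log ρ + c, ?_⟩
      rw [add_sub_cancel_right, mul_div_cancel_left₀ _ hκ, Real.exp_log hρ]
  have hder : ∀ σ ∈ univ, HasDerivWithinAt (fun σ : ℝ => Real.exp ((σ - c) / κ))
      (Real.exp ((σ - c) / κ) * (1 / κ)) univ σ := fun σ _ =>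
    ((((hasDerivAt_id σ).sub_const c).div_const κ).exp).hasDerivWithinAt
  have hinj : InjOn (fun σ : ℝ => Real.exp ((σ - c) / κ)) univ := by
    intro x _ y _ h
    have := Real.exp_injective h
    field_simp at this
    linarith
  rw [← himg, lintegral_image_eq_lintegral_abs_deriv_mul MeasurableSet.univ hder hinj,
    Measure.restrict_univ, ← lintegral_const_mul' _ _ ENNReal.ofReal_ne_top]
  refine lintegral_congr fun σ => ?_
  rw [← mul_assoc, ← ENNReal.ofReal_mul (abs_nonneg _), Real.log_exp, mul_div_cancel₀ _ hκ,
    sub_add_cancel, abs_mul, abs_of_pos (Real.exp_pos _), mul_right_comm,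
    mul_inv_cancel₀ (Real.exp_pos _).ne', one_mul, one_div, abs_inv]

/-- Integration of a function of a log-homogeneous function `ℓ` against a weight `k` that is
homogeneous of degree `-d`. -/
theorem lintegral_orthant_homogeneous (n : ℕ) {k ℓ : (Fin (n + 1) → ℝ) → ℝ} {κ : ℝ} (hκ : κ ≠ 0)
    (hk : Measurable k) (hℓ : Measurable ℓ)
    (hkh : ∀ ρ > 0, ∀ t : Fin (n + 1) → ℝ, (∀ i, 0 < t i) →
      k (fun j => ρ * t j) = (ρ ^ (n + 1))⁻¹ * k t)
    (hℓh : ∀ ρ > 0, ∀ t : Fin (n + 1) → ℝ, (∀ i, 0 < t i) →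
      ℓ (fun j => ρ * t j) = κ * Real.log ρ + ℓ t)
    {F : ℝ → ℝ≥0∞} (hF : Measurable F) :
    ∫⁻ t, ENNReal.ofReal (k t) * F (ℓ t) ∂(orthantMeasure (n + 1)) =
      (∫⁻ ω in angularCube (n + 1),
        ENNReal.ofReal (angularJacobian (n + 1) ω * k (sphereCoord (n + 1) ω))) *
      (ENNReal.ofReal |κ|⁻¹ * ∫⁻ v, F v) := by
  have hf : Measurable fun t => ENNReal.ofReal (k t) * F (ℓ t) := by fun_prop
  have hs : Measurable fun ω : Fin n → ℝ => sphereCoord (n + 1) ω :=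
    measurable_pi_iff.2 fun j => (continuous_sphereCoord (n + 1) j).measurable
  have hJ : Measurable fun ω : Fin n → ℝ => angularJacobian (n + 1) ω :=
    (continuous_angularJacobian (n + 1)).measurable
  have hm : Measurable fun ω : Fin n → ℝ =>
      ENNReal.ofReal (angularJacobian (n + 1) ω * k (sphereCoord (n + 1) ω)) :=
    (hJ.mul (hk.comp hs)).ennreal_ofReal
  have hang : (∫⁻ ω in angularCube (n + 1),
      ENNReal.ofReal (angularJacobian (n + 1) ω * k (sphereCoord (n + 1) ω))) =
      ∫⁻ ω : Fin n → ℝ, ENNReal.ofReal (angularJacobian (n + 1) ω * k (sphereCoord (n + 1) ω))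
        ∂(Measure.pi fun _ : Fin n => (volume : Measure ℝ).restrict (Ioo 0 (Real.pi / 2))) :=
    congrArg (fun μ : Measure (Fin n → ℝ) => ∫⁻ ω,
      ENNReal.ofReal (angularJacobian (n + 1) ω * k (sphereCoord (n + 1) ω)) ∂μ)
      (restrict_angularCube n)
  rw [orthantMeasure_eq_pi, lintegral_orthant_polar n hf, hang, ← lintegral_mul_const _ hm]
  refine lintegral_congr_ae ?_
  filter_upwards [ae_angle_mem n] with ω hω
  rw [← lintegral_comp_log hκ (ℓ (sphereCoord (n + 1) ω)) F, ← lintegral_const_mul' _ _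
    ENNReal.ofReal_ne_top]
  refine setLIntegral_congr_fun measurableSet_Ioi fun ρ (hρ : 0 < ρ) => ?_
  rw [hkh ρ hρ _ (sphereCoord_pos hω), hℓh ρ hρ _ (sphereCoord_pos hω), ← mul_assoc, ← mul_assoc,
    ← ENNReal.ofReal_mul (by have := (angularJacobian_pos hω).le; positivity),
    ← ENNReal.ofReal_mul' (by positivity)]
  congr 2
  field_simp
  ring

/-! ### Beta integrals -/

lemma lintegral_beta {a b : ℝ} (ha : 0 < a) (hb : 0 < b) :
    ∫⁻ φ in Ioo (0 : ℝ) 1, ENNReal.ofReal (φ ^ (a - 1) * (1 - φ) ^ (b - 1)) =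
      ENNReal.ofReal (ProbabilityTheory.beta a b) := by
  have hB := ProbabilityTheory.beta_pos ha hb
  have h := ProbabilityTheory.lintegral_betaPDF_eq_one ha hb
  rw [ProbabilityTheory.lintegral_betaPDF] at h
  rw [← mul_one (ENNReal.ofReal (ProbabilityTheory.beta a b)), ← h,
    ← lintegral_const_mul' _ _ ENNReal.ofReal_ne_top]
  refine lintegral_congr fun φ => ?_
  rw [← ENNReal.ofReal_mul hB.le]
  congr 1
  field_simp

lemma beta_add_one_left {a b : ℝ} (ha : 0 < a) (hb : 0 < b) :
    ProbabilityTheory.beta (a + 1) b = a / (a + b) * ProbabilityTheory.beta a b := by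
  unfold ProbabilityTheory.beta
  have := (Real.Gamma_pos_of_pos (add_pos ha hb)).ne'
  rw [show a + 1 + b = a + b + 1 by ring, Real.Gamma_add_one ha.ne',
    Real.Gamma_add_one (add_pos ha hb).ne']
  field_simp

lemma beta_add_one_right {a b : ℝ} (ha : 0 < a) (hb : 0 < b) :
    ProbabilityTheory.beta a (b + 1) = b / (a + b) * ProbabilityTheory.beta a b := by
  unfold ProbabilityTheory.beta
  have := (Real.Gamma_pos_of_pos (add_pos ha hb)).ne'
  rw [show a + (b + 1) = a + b + 1 by ring, Real.Gamma_add_one hb.ne',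
    Real.Gamma_add_one (add_pos ha hb).ne']
  field_simp

theorem lintegral_logRatioInv {p q r : ℝ} (hp : q ≤ p) (hr : q ≤ r)
    (h : 0 < (r - q) + (p - q)) {a b : ℝ} (ha : 0 < a) (hb : 0 < b) :
    ∫⁻ v, ENNReal.ofReal (logRatioInv p q r v ^ a * (1 - logRatioInv p q r v) ^ b) =
      ENNReal.ofReal (((r - q) * b + (p - q) * a) / (a + b) * ProbabilityTheory.beta a b) := by
  have hmono := strictMonoOn_logRatio hp hr h
  have hder : ∀ φ ∈ Ioo (0 : ℝ) 1, HasDerivWithinAt (logRatio p q r)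
      ((r - q) / φ + (p - q) / (1 - φ)) (Ioo 0 1) φ :=
    fun φ hφ => (hasDerivAt_logRatio p q r hφ).hasDerivWithinAt
  have himg : MeasurableSet (logRatio p q r '' Ioo 0 1) :=
    measurable_image_of_fderivWithin measurableSet_Ioo
      (fun φ hφ => (hder φ hφ).hasFDerivWithinAt) hmono.injOn
  have hB := ProbabilityTheory.beta_pos ha hb
  -- Off the range of `logRatio` the inverse equals 0 or 1 and the positive exponents kill the
  -- integrand; on the range, substitute v = `logRatio` φ.
  rw [← lintegral_add_compl _ himg, setLIntegral_eq_zero himg.compl, add_zero,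
    lintegral_image_eq_lintegral_abs_deriv_mul measurableSet_Ioo hder hmono.injOn]
  -- The two terms of the derivative give beta integrals with parameters (a, b+1) and (a+1, b).
  · have e1 : ∀ φ ∈ Ioo (0 : ℝ) 1, ENNReal.ofReal |(r - q) / φ + (p - q) / (1 - φ)| *
        ENNReal.ofReal (logRatioInv p q r (logRatio p q r φ) ^ a *
          (1 - logRatioInv p q r (logRatio p q r φ)) ^ b) =
        ENNReal.ofReal (r - q) * ENNReal.ofReal (φ ^ (a - 1) * (1 - φ) ^ (b + 1 - 1)) +
        ENNReal.ofReal (p - q) * ENNReal.ofReal (φ ^ (a + 1 - 1) * (1 - φ) ^ (b - 1)) := by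
      intro φ hφ
      have h1 : 0 < 1 - φ := sub_pos.2 hφ.2
      have h2 : 0 ≤ (r - q) / φ := div_nonneg (sub_nonneg.2 hr) hφ.1.le
      have h3 : 0 ≤ (p - q) / (1 - φ) := div_nonneg (sub_nonneg.2 hp) h1.le
      have h4 := Real.rpow_pos_of_pos hφ.1 a
      have h5 := Real.rpow_pos_of_pos h1 b
      have h6 := Real.rpow_pos_of_pos hφ.1 (a - 1)
      have h7 := Real.rpow_pos_of_pos h1 (b - 1)
      rw [logRatioInv_logRatio hp hr h hφ, abs_of_nonneg (add_nonneg h2 h3),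
        ← ENNReal.ofReal_mul (add_nonneg h2 h3), ← ENNReal.ofReal_mul (sub_nonneg.2 hr),
        ← ENNReal.ofReal_mul (sub_nonneg.2 hp), add_sub_cancel_right, add_sub_cancel_right,
        ← ENNReal.ofReal_add (mul_nonneg (sub_nonneg.2 hr) (by positivity))
          (mul_nonneg (sub_nonneg.2 hp) (by positivity)), Real.rpow_sub_one hφ.1.ne',
        Real.rpow_sub_one h1.ne']
      congr 1
      field_simp
    rw [setLIntegral_congr_fun measurableSet_Ioo e1, lintegral_add_left (by fun_prop),
      lintegral_const_mul' _ _ ENNReal.ofReal_ne_top, lintegral_const_mul' _ _ ENNReal.ofReal_ne_top,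
      lintegral_beta ha (by linarith), lintegral_beta (by linarith) hb,
      ← ENNReal.ofReal_mul (sub_nonneg.2 hr), ← ENNReal.ofReal_mul (sub_nonneg.2 hp),
      beta_add_one_left ha hb, beta_add_one_right ha hb, ← ENNReal.ofReal_add
        (mul_nonneg (sub_nonneg.2 hr) (by positivity))
        (mul_nonneg (sub_nonneg.2 hp) (by positivity))]
    congr 1
    field_simp
  · intro v hv
    have hnot : ¬ logRatioInv p q r v ∈ Ioo (0 : ℝ) 1 := fun hmem =>
      hv ⟨_, hmem, logRatio_logRatioInv hp hr h hmem⟩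
    rcases (logRatioInv_nonneg (p := p) (q := q) (r := r) v).eq_or_lt with h0 | h0
    · simp [← h0, Real.zero_rpow ha.ne']
    · have h1 : logRatioInv p q r v = 1 := le_antisymm (logRatioInv_le_one _) (by
        by_contra! hlt
        exact hnot ⟨h0, hlt⟩)
      simp [h1, Real.zero_rpow hb.ne']

/-! ### Logarithms of the weights -/

/-- The logarithm of the Euclidean norm. -/
def logRadius {d : ℕ} (t : Fin d → ℝ) : ℝ := Real.log (∑ i, t i ^ 2) / 2

/-- The logarithm of `∑ⱼ tⱼ ^ e`. -/
def logPowerSum {d : ℕ} (e : ℝ) (t : Fin d → ℝ) : ℝ := Real.log (∑ i, t i ^ e)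

@[fun_prop]
lemma measurable_logRadius {d : ℕ} : Measurable (logRadius (d := d)) := by
  unfold logRadius
  fun_prop

@[fun_prop]
lemma measurable_logPowerSum {d : ℕ} (e : ℝ) : Measurable (logPowerSum (d := d) e) := by
  unfold logPowerSum
  fun_prop

lemma sum_sq_pos {n : ℕ} {t : Fin (n + 1) → ℝ} (ht : ∀ i, 0 < t i) : 0 < ∑ i, t i ^ 2 :=
  Finset.sum_pos (fun i _ => pow_pos (ht i) 2) ⟨0, Finset.mem_univ _⟩

lemma sum_rpow_pos {n : ℕ} {t : Fin (n + 1) → ℝ} (ht : ∀ i, 0 < t i) (e : ℝ) :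
    0 < ∑ i, t i ^ e :=
  Finset.sum_pos (fun i _ => Real.rpow_pos_of_pos (ht i) e) ⟨0, Finset.mem_univ _⟩

lemma logRadius_smul {n : ℕ} {ρ : ℝ} (hρ : 0 < ρ) {t : Fin (n + 1) → ℝ} (ht : ∀ i, 0 < t i) :
    logRadius (fun j => ρ * t j) = Real.log ρ + logRadius t := by
  unfold logRadius
  simp_rw [mul_pow, ← Finset.mul_sum]
  rw [Real.log_mul (by positivity) (sum_sq_pos ht).ne', Real.log_pow]
  push_cast
  ring

lemma logPowerSum_smul {n : ℕ} (e : ℝ) {ρ : ℝ} (hρ : 0 < ρ) {t : Fin (n + 1) → ℝ}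
    (ht : ∀ i, 0 < t i) :
    logPowerSum e (fun j => ρ * t j) = e * Real.log ρ + logPowerSum e t := by
  unfold logPowerSum
  rw [Finset.sum_congr rfl fun j _ => Real.mul_rpow hρ.le (ht j).le, ← Finset.mul_sum,
    Real.log_mul (Real.rpow_pos_of_pos hρ e).ne' (sum_rpow_pos ht e).ne', Real.log_rpow hρ]

lemma logRadius_sphereCoord {n : ℕ} (ω : Fin n → ℝ) :
    logRadius (sphereCoord (n + 1) ω) = 0 := by
  simp [logRadius, sum_sphereCoord_sq]

lemma radialWeight_eq_exp {n : ℕ} (θ : ℝ) {t : Fin (n + 1) → ℝ} (ht : ∀ i, 0 < t i) :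
    radialWeight (n + 1) θ t = Real.exp (θ * logRadius t) := by
  rw [radialWeight, logRadius, Real.rpow_def_of_pos (sum_sq_pos ht)]
  congr 1
  ring

lemma exp_logPowerSum {n : ℕ} (e : ℝ) {t : Fin (n + 1) → ℝ} (ht : ∀ i, 0 < t i) :
    Real.exp (logPowerSum e t) = ∑ i, t i ^ e :=
  Real.exp_log (sum_rpow_pos ht e)

/-! ### The angular integral -/

lemma isCompact_angularCube (d : ℕ) : IsCompact (angularCube d) := by
  have : angularCube d = Set.pi univ fun _ => Icc 0 (Real.pi / 2) := by
    ext ω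
    simp only [angularCube, mem_ofPred_eq, mem_univ_pi]
  rw [this]
  exact isCompact_univ_pi fun _ => isCompact_Icc

lemma sum_sphereCoord_rpow_pos {n : ℕ} {ω : Fin n → ℝ} (hω : ω ∈ angularCube (n + 1)) (e : ℝ) :
    0 < ∑ k, sphereCoord (n + 1) ω k ^ e := by
  obtain ⟨k, hk⟩ : ∃ k, 0 < sphereCoord (n + 1) ω k := by
    by_contra! h
    have h0 : ∀ k, sphereCoord (n + 1) ω k = 0 := fun k =>
      le_antisymm (h k) (sphereCoord_nonneg hω k)
    simpa [h0] using sum_sphereCoord_sq n ω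
  exact Finset.sum_pos' (fun j _ => Real.rpow_nonneg (sphereCoord_nonneg hω j) e)
    ⟨k, Finset.mem_univ _, Real.rpow_pos_of_pos hk e⟩

/-- The integrand is continuous on the compact cube: e > 0 keeps the powers continuous where a
coordinate vanishes, and the coordinates never vanish simultaneously because their squares sum to
one. -/
lemma integrableOn_angularIntegrand (n : ℕ) {e : ℝ} (he : 0 < e) (m : ℝ) :
    IntegrableOn (angularIntegrand (n + 1) e m) (angularCube (n + 1)) := by
  refine ContinuousOn.integrableOn_compact (isCompact_angularCube _) ?_
  have hs : Continuous fun ω => ∑ k, sphereCoord (n + 1) ω k ^ e :=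
    continuous_finsetSum _ fun k _ =>
      (continuous_sphereCoord (n + 1) k).rpow_const fun _ => Or.inr he.le
  refine (continuous_angularJacobian _).continuousOn.div
    (hs.continuousOn.rpow_const fun ω hω => Or.inl (sum_sphereCoord_rpow_pos hω e).ne')
    fun ω hω => (Real.rpow_pos_of_pos (sum_sphereCoord_rpow_pos hω e) m).ne'

lemma angularIntegrand_pos {n : ℕ} {ω : Fin n → ℝ} (hω : ∀ i, ω i ∈ Ioo 0 (Real.pi / 2))
    (e m : ℝ) : 0 < angularIntegrand (n + 1) e m ω :=
  div_pos (angularJacobian_pos hω)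
    (Real.rpow_pos_of_pos (sum_rpow_pos (sphereCoord_pos hω) e) m)

lemma ae_angularIntegrand_pos (n : ℕ) (e m : ℝ) :
    ∀ᵐ ω ∂(volume.restrict (angularCube (n + 1))), 0 < angularIntegrand (n + 1) e m ω := by
  have h := ae_angle_mem n
  rw [← restrict_angularCube n] at h
  filter_upwards [h] with ω hω using angularIntegrand_pos hω e m

lemma lintegral_angularIntegrand (n : ℕ) {e : ℝ} (he : 0 < e) (m : ℝ) :
    ∫⁻ ω in angularCube (n + 1), ENNReal.ofReal (angularIntegrand (n + 1) e m ω) =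
      ENNReal.ofReal (angularIntegral (n + 1) e m) :=
  (ofReal_integral_eq_lintegral_ofReal (integrableOn_angularIntegrand n he m)
    ((ae_angularIntegrand_pos n e m).mono fun _ h => h.le)).symm

lemma angularIntegral_pos (n : ℕ) {e : ℝ} (he : 0 < e) (m : ℝ) :
    0 < angularIntegral (n + 1) e m := by
  have hpos := ae_angularIntegrand_pos n e m
  refine (integral_pos_iff_support_of_nonneg_ae (hpos.mono fun _ h => h.le)
    (integrableOn_angularIntegrand n he m)).2 ?_
  have h1 : (volume.restrict (angularCube (n + 1)))
      (Function.support (angularIntegrand (n + 1) e m))ᶜ = 0 := by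
    refine measure_mono_null (fun ω hω => ?_) hpos
    simp only [Function.mem_support, mem_compl_iff, not_not] at hω
    simp [hω]
  have h2 : (volume.restrict (angularCube (n + 1))) univ ≠ 0 := by
    have := restrict_angularCube n
    erw [this, Measure.pi_univ]
    have := Real.pi_pos
    refine Finset.prod_ne_zero_iff.2 fun i _ => ?_
    simp
    linarith
  rw [pos_iff_ne_zero]
  intro h0
  refine h2 (le_antisymm ?_ zero_le)
  rw [← union_compl_self (Function.support (angularIntegrand (n + 1) e m))]
  exact (measure_union_le _ _).trans (by rw [h0, h1, add_zero])

/-! ### Energies -/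

/-- The relations between the parameters of the inequality in dimension `d`. -/
structure Parameters (d : ℕ) (p q r θ θ₀ θ₁ γ s : ℝ) : Prop where
  one_le : 1 ≤ q
  le_left : q ≤ p
  le_right : q ≤ r
  gap : 0 < (r - q) + (p - q)
  coord_pos : 0 < θ₁
  mem : γ ∈ Ioo (0 : ℝ) 1
  s_pos : 0 < s
  s_eq : s * (1 / q - γ / p - (1 - γ) / r) = 1
  -- Given `s_eq`, this is equivalent to θ + d/q = γ(θ₀ + d/p) + (1-γ)(θ₁ + d/r). In this form it
  -- says that the exponential factor of the density is homogeneous of degree -d.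
  degree : s * (θ - γ * θ₀ - (1 - γ) * θ₁) = -d
  ne : θ₁ + d / r ≠ θ₀ + d / p

/-- The value at `t` of the extremal function. -/
def extremal {d : ℕ} (p q r θ θ₀ θ₁ γ s : ℝ) (t : Fin d → ℝ) : ℝ :=
  extremalValue p q r γ s (θ * logRadius t) (θ₀ * logRadius t) (logPowerSum (r * θ₁) t)

/-- The `q`-energy of the extremal function. -/
def energy (d : ℕ) (p r θ₀ θ₁ γ s : ℝ) : ℝ :=
  ProbabilityTheory.beta (s * γ / p) (s * (1 - γ) / r) *
    angularIntegral d (r * θ₁) (s * (1 - γ) / r) /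
      (|θ₁ + d / r - (θ₀ + d / p)| * (γ * r + (1 - γ) * p))

section
variable {n : ℕ} {p q r θ θ₀ θ₁ γ s : ℝ}

lemma measurable_extremal : Measurable (extremal (d := n + 1) p q r θ θ₀ θ₁ γ s) := by
  have := (monotone_logRatioInv (p := p) (q := q) (r := r)).measurable
  unfold extremal extremalValue extremalDensity
  fun_prop

lemma extremal_nonneg (t : Fin (n + 1) → ℝ) : 0 ≤ extremal p q r θ θ₀ θ₁ γ s t :=
  extremalValue_nonneg _ _ _

variable (H : Parameters (n + 1) p q r θ θ₀ θ₁ γ s)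
include H

lemma Parameters.q_pos : 0 < q := zero_lt_one.trans_le H.one_le
lemma Parameters.p_pos : 0 < p := H.q_pos.trans_le H.le_left
lemma Parameters.r_pos : 0 < r := H.q_pos.trans_le H.le_right
lemma Parameters.γ_pos : 0 < γ := H.mem.1
lemma Parameters.γ'_pos : 0 < 1 - γ := sub_pos.2 H.mem.2
lemma Parameters.a_pos : 0 < s * γ / p := div_pos (mul_pos H.s_pos H.γ_pos) H.p_pos
lemma Parameters.b_pos : 0 < s * (1 - γ) / r := div_pos (mul_pos H.s_pos H.γ'_pos) H.r_pos

lemma energy_pos : 0 < energy (n + 1) p r θ₀ θ₁ γ s := by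
  have hp := H.p_pos
  have hr := H.r_pos
  have hγ := H.γ_pos
  have hγ' := H.γ'_pos
  have hI := angularIntegral_pos n (mul_pos hr H.coord_pos) (s * (1 - γ) / r)
  have hB := ProbabilityTheory.beta_pos H.a_pos H.b_pos
  have hτ := abs_pos.2 (sub_ne_zero.2 H.ne)
  unfold energy
  positivity

/-- The degree of log-homogeneity of the argument of `logRatioInv`. -/
lemma degree_eq : p * (r - q) * θ₀ + q * (p - r) * θ - (p - q) * (r * θ₁) =
    -(p * q * r / s * (θ₁ + ((n + 1 : ℕ) : ℝ) / r - (θ₀ + ((n + 1 : ℕ) : ℝ) / p))) := by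
  have hp := H.p_pos
  have hr := H.r_pos
  have hq := H.q_pos
  have hs := H.s_pos
  have h1 := H.s_eq
  have h2 := H.degree
  have e1 : 1 / s = 1 / q - γ / p - (1 - γ) / r := by
    field_simp at h1 ⊢
    linarith
  have e2 : θ = γ * θ₀ + (1 - γ) * θ₁ - ((n + 1 : ℕ) : ℝ) * (1 / q - γ / p - (1 - γ) / r) := by
    rw [← e1]
    field_simp
    linarith
  rw [e2, div_eq_mul_one_div (p * q * r) s, e1]
  field_simp
  ring

lemma lintegral_density {a b : ℝ} (ha : 0 < a) (hb : 0 < b) {F : (Fin (n + 1) → ℝ) → ℝ}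
    (hF : ∀ t, F t = Real.exp (s * (θ * logRadius t - γ * (θ₀ * logRadius t) -
      (1 - γ) / r * logPowerSum (r * θ₁) t)) *
      (logRatioInv p q r (p * (r - q) * (θ₀ * logRadius t) + q * (p - r) * (θ * logRadius t) -
        (p - q) * logPowerSum (r * θ₁) t) ^ a *
      (1 - logRatioInv p q r (p * (r - q) * (θ₀ * logRadius t) + q * (p - r) * (θ * logRadius t) -
        (p - q) * logPowerSum (r * θ₁) t)) ^ b)) :
    ∫⁻ t, ENNReal.ofReal (F t) ∂(orthantMeasure (n + 1)) =
      ENNReal.ofReal (angularIntegral (n + 1) (r * θ₁) (s * (1 - γ) / r) *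
        (s / (p * q * r * |θ₁ + ((n + 1 : ℕ) : ℝ) / r - (θ₀ + ((n + 1 : ℕ) : ℝ) / p)|) *
        (((r - q) * b + (p - q) * a) / (a + b) * ProbabilityTheory.beta a b))) := by
  have hp := H.p_pos
  have hr := H.r_pos
  have hq := H.q_pos
  have hs := H.s_pos
  have hτ := sub_ne_zero.2 H.ne
  -- The condition `ne` makes the argument of `logRatioInv` genuinely vary along rays, as the radial
  -- substitution requires.
  have hI := angularIntegral_pos n (mul_pos hr H.coord_pos) (s * (1 - γ) / r)
  have hκ : p * (r - q) * θ₀ + q * (p - r) * θ - (p - q) * (r * θ₁) ≠ 0 := by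
    rw [degree_eq H]
    exact neg_ne_zero.2 (mul_ne_zero (by positivity) hτ)
  have hκ' : |p * (r - q) * θ₀ + q * (p - r) * θ - (p - q) * (r * θ₁)|⁻¹ =
      s / (p * q * r * |θ₁ + ((n + 1 : ℕ) : ℝ) / r - (θ₀ + ((n + 1 : ℕ) : ℝ) / p)|) := by
    rw [degree_eq H, abs_neg, abs_mul, abs_of_pos (by positivity), mul_inv, inv_div]
    field_simp
  have hΦ := (monotone_logRatioInv (p := p) (q := q) (r := r)).measurable
  have main := lintegral_orthant_homogeneous n (F := fun v =>
      ENNReal.ofReal (logRatioInv p q r v ^ a * (1 - logRatioInv p q r v) ^ b)) hκ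
    (k := fun t => Real.exp (s * (θ * logRadius t - γ * (θ₀ * logRadius t) -
      (1 - γ) / r * logPowerSum (r * θ₁) t)))
    (ℓ := fun t => p * (r - q) * (θ₀ * logRadius t) + q * (p - r) * (θ * logRadius t) -
        (p - q) * logPowerSum (r * θ₁) t) (by fun_prop) (by fun_prop)
    (by
      intro ρ hρ t ht
      rw [logRadius_smul hρ ht, logPowerSum_smul _ hρ ht]
      have : (ρ ^ (n + 1))⁻¹ = Real.exp (-((n + 1 : ℕ) : ℝ) * Real.log ρ) := by
        rw [neg_mul, Real.exp_neg, Real.exp_nat_mul, Real.exp_log hρ]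
      rw [this, ← Real.exp_add, ← H.degree]
      congr 1
      field_simp
      ring)
    (by
      intro ρ hρ t ht
      rw [logRadius_smul hρ ht, logPowerSum_smul _ hρ ht]
      ring) (by fun_prop)
  rw [lintegral_logRatioInv H.le_left H.le_right H.gap ha hb, hκ'] at main
  have hang : ∫⁻ ω in angularCube (n + 1), ENNReal.ofReal (angularJacobian (n + 1) ω *
      Real.exp (s * (θ * logRadius (sphereCoord (n + 1) ω) -
        γ * (θ₀ * logRadius (sphereCoord (n + 1) ω)) -
        (1 - γ) / r * logPowerSum (r * θ₁) (sphereCoord (n + 1) ω)))) =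
      ENNReal.ofReal (angularIntegral (n + 1) (r * θ₁) (s * (1 - γ) / r)) := by
    rw [← lintegral_angularIntegrand n (mul_pos hr H.coord_pos)]
    refine setLIntegral_congr_fun (isCompact_angularCube _).measurableSet fun ω hω => ?_
    have hpos := sum_sphereCoord_rpow_pos hω (r * θ₁)
    -- On the unit sphere the radial weights are 1, so only the power sum survives.
    rw [logRadius_sphereCoord, angularIntegrand, div_eq_mul_inv (angularJacobian _ _), ← Real.rpow_neg hpos.le,
      Real.rpow_def_of_pos hpos, logPowerSum]
    congr 3
    ring
  rw [hang, ← ENNReal.ofReal_mul (by positivity), ← ENNReal.ofReal_mul hI.le] at main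
  rw [← main]
  refine lintegral_congr fun t => ?_
  rw [hF, ENNReal.ofReal_mul (Real.exp_pos _).le]

/-- Multiplying the density by the share raises the first beta exponent by one; the recurrence of
the beta function then produces the factor γ. -/
lemma lintegral_extremal_left :
    ∫⁻ t, ENNReal.ofReal (Real.exp (p * (θ₀ * logRadius t)) *
      extremal p q r θ θ₀ θ₁ γ s t ^ p) ∂(orthantMeasure (n + 1)) =
      ENNReal.ofReal (γ * energy (n + 1) p r θ₀ θ₁ γ s) := by
  have hp := H.p_pos
  have hr := H.r_pos
  have hq := H.q_pos
  have hs := H.s_pos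
  have ha := H.a_pos
  have hb := H.b_pos
  have hγ := H.γ_pos
  have hγ' := H.γ'_pos
  have hτ := abs_ne_zero.2 (sub_ne_zero.2 H.ne)
  rw [lintegral_density H (a := s * γ / p + 1) (b := s * (1 - γ) / r) (by linarith) hb]
  · congr 1
    rw [beta_add_one_left ha hb, energy]
    have h1 := H.s_eq
    have e1 : s = q * (1 + s * γ / p + s * (1 - γ) / r) := by
      field_simp at h1 ⊢
      linarith
    -- The normalisation of s, in the form `e1`, collapses the coefficient from the change of
    -- variables to p.
    have e2 : (r - q) * (s * (1 - γ) / r) + (p - q) * (s * γ / p + 1) = p := by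
      have : (r - q) * (s * (1 - γ) / r) + (p - q) * (s * γ / p + 1) =
        s - q * (1 + s * γ / p + s * (1 - γ) / r) + p := by field_simp; ring
      linarith
    rw [e2]
    have e3 : s * γ / p + 1 + s * (1 - γ) / r = s / q := by
      rw [eq_div_iff hq.ne']
      linarith
    have e4 : s * γ / p + s * (1 - γ) / r = s * (γ * r + (1 - γ) * p) / (p * r) := by
      field_simp
    have : 0 < γ * r + (1 - γ) * p := by positivity
    rw [e3, e4]
    set τ := |θ₁ + ((n + 1 : ℕ) : ℝ) / r - (θ₀ + ((n + 1 : ℕ) : ℝ) / p)|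
    field_simp
  · intro t
    have := exp_mul_extremalValue_rpow_left hq H.le_left H.le_right H.gap H.mem hs H.s_eq
      (θ * logRadius t) (θ₀ * logRadius t) (logPowerSum (r * θ₁) t)
    rw [extremal, this, extremalDensity, Real.rpow_add_one' (logRatioInv_nonneg _) (by linarith)]
    ring

lemma lintegral_extremal_right :
    ∫⁻ t, ENNReal.ofReal (Real.exp (logPowerSum (r * θ₁) t) *
      extremal p q r θ θ₀ θ₁ γ s t ^ r) ∂(orthantMeasure (n + 1)) =
      ENNReal.ofReal ((1 - γ) * energy (n + 1) p r θ₀ θ₁ γ s) := by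
  have hp := H.p_pos
  have hr := H.r_pos
  have hq := H.q_pos
  have hs := H.s_pos
  have ha := H.a_pos
  have hb := H.b_pos
  have hγ := H.γ_pos
  have hγ' := H.γ'_pos
  have hτ := abs_ne_zero.2 (sub_ne_zero.2 H.ne)
  rw [lintegral_density H (a := s * γ / p) (b := s * (1 - γ) / r + 1) ha (by linarith)]
  · congr 1
    rw [beta_add_one_right ha hb, energy]
    have h1 := H.s_eq
    have e1 : s = q * (1 + s * γ / p + s * (1 - γ) / r) := by
      field_simp at h1 ⊢
      linarith
    have e2 : (r - q) * (s * (1 - γ) / r + 1) + (p - q) * (s * γ / p) = r := by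
      have : (r - q) * (s * (1 - γ) / r + 1) + (p - q) * (s * γ / p) =
        s - q * (1 + s * γ / p + s * (1 - γ) / r) + r := by field_simp; ring
      linarith
    rw [e2]
    have e3 : s * γ / p + (s * (1 - γ) / r + 1) = s / q := by
      rw [eq_div_iff hq.ne']
      linarith
    have e4 : s * γ / p + s * (1 - γ) / r = s * (γ * r + (1 - γ) * p) / (p * r) := by
      field_simp
    have : 0 < γ * r + (1 - γ) * p := by positivity
    rw [e3, e4]
    set τ := |θ₁ + ((n + 1 : ℕ) : ℝ) / r - (θ₀ + ((n + 1 : ℕ) : ℝ) / p)|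
    field_simp
  · intro t
    have := exp_mul_extremalValue_rpow_right hq H.le_left H.le_right H.gap H.mem hs H.s_eq
      (θ * logRadius t) (θ₀ * logRadius t) (logPowerSum (r * θ₁) t)
    rw [extremal, this, extremalDensity,
      Real.rpow_add_one' (sub_nonneg.2 (logRatioInv_le_one _)) (by linarith)]
    ring

lemma lintegral_extremal :
    ∫⁻ t, ENNReal.ofReal (Real.exp (q * (θ * logRadius t)) *
      extremal p q r θ θ₀ θ₁ γ s t ^ q) ∂(orthantMeasure (n + 1)) =
      ENNReal.ofReal (energy (n + 1) p r θ₀ θ₁ γ s) := by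
  have hE := energy_pos H
  have hy := measurable_extremal (n := n) (p := p) (q := q) (r := r) (θ := θ) (θ₀ := θ₀)
    (θ₁ := θ₁) (γ := γ) (s := s)
  have hsum : energy (n + 1) p r θ₀ θ₁ γ s = γ * energy (n + 1) p r θ₀ θ₁ γ s +
      (1 - γ) * energy (n + 1) p r θ₀ θ₁ γ s := by ring
  rw [hsum, ENNReal.ofReal_add (mul_pos H.γ_pos hE).le (mul_pos H.γ'_pos hE).le,
    ← lintegral_extremal_left H, ← lintegral_extremal_right H, ← lintegral_add_left (by fun_prop)]
  refine lintegral_congr fun t => ?_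
  have hnn := fun e => Real.rpow_nonneg (extremal_nonneg (p := p) (q := q) (r := r)
    (θ := θ) (θ₀ := θ₀) (θ₁ := θ₁) (γ := γ) (s := s) t) e
  rw [← ENNReal.ofReal_add (mul_nonneg (Real.exp_pos _).le (hnn p))
    (mul_nonneg (Real.exp_pos _).le (hnn r))]
  congr 1
  unfold extremal
  rw [exp_mul_extremalValue_rpow H.q_pos,
    exp_mul_extremalValue_rpow_left H.q_pos H.le_left H.le_right H.gap H.mem H.s_pos H.s_eq,
    exp_mul_extremalValue_rpow_right H.q_pos H.le_left H.le_right H.gap H.mem H.s_pos H.s_eq]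
  ring

end

/-! ### The inequality for nonnegative functions -/

lemma map_smul_orthantMeasure (d : ℕ) {δ : ℝ} (hδ : 0 < δ) :
    (orthantMeasure d).map (fun t => δ • t) =
      ENNReal.ofReal (δ ^ d)⁻¹ • orthantMeasure d := by
  have hS : MeasurableSet {t : Fin d → ℝ | ∀ i, 0 ≤ t i} := by
    have : {t : Fin d → ℝ | ∀ i, 0 ≤ t i} = Ici 0 := by ext t; simp [Pi.le_def]
    rw [this]
    exact measurableSet_Ici
  have h := Measure.map_addHaar_smul (volume : Measure (Fin d → ℝ)) hδ.ne'
  rw [Module.finrank_fin_fun, abs_of_pos (by positivity)] at h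
  have hpre : (fun t : Fin d → ℝ => δ • t) ⁻¹' {t | ∀ i, 0 ≤ t i} = {t | ∀ i, 0 ≤ t i} := by
    ext t
    simp [mul_nonneg_iff_of_pos_left hδ]
  have h2 := Measure.restrict_map (μ := (volume : Measure (Fin d → ℝ)))
    (measurable_const_smul δ : Measurable fun t : Fin d → ℝ => δ • t) hS
  rw [hpre, h] at h2
  rw [orthantMeasure, ← h2, Measure.restrict_smul]

lemma lintegral_orthant_smul (d : ℕ) {δ : ℝ} (hδ : 0 < δ) {f : (Fin d → ℝ) → ℝ≥0∞}
    (hf : Measurable f) : ∫⁻ t, f (fun j => δ * t j) ∂(orthantMeasure d) =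
      ENNReal.ofReal (δ ^ d)⁻¹ * ∫⁻ t, f t ∂(orthantMeasure d) := by
  have h := lintegral_map (μ := orthantMeasure d) hf
    (measurable_const_smul δ : Measurable fun t : Fin d → ℝ => δ • t)
  rw [map_smul_orthantMeasure d hδ, lintegral_smul_measure] at h
  exact h.symm

/-- Scaling of a weighted power integral whose weight has a logarithm that is log-homogeneous of
degree `m * θ`. -/
lemma lintegral_scaled (n : ℕ) {m θ c δ : ℝ} (hm : 0 < m) (hc : 0 < c) (hδ : 0 < δ)
    {l : (Fin (n + 1) → ℝ) → ℝ} (hl : Measurable l)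
    (hlh : ∀ t : Fin (n + 1) → ℝ, (∀ i, 0 < t i) →
      l (fun j => δ * t j) = m * θ * Real.log δ + l t)
    {z : (Fin (n + 1) → ℝ) → ℝ} (hz : Measurable z) (hz0 : ∀ t, 0 ≤ z t) :
    ∫⁻ t, ENNReal.ofReal (Real.exp (l t) * (c * z (fun j => δ * t j)) ^ m)
        ∂(orthantMeasure (n + 1)) =
      ENNReal.ofReal (Real.exp (m * (Real.log c -
        (θ + ((n + 1 : ℕ) : ℝ) / m) * Real.log δ))) *
      ∫⁻ t, ENNReal.ofReal (Real.exp (l t) * z t ^ m) ∂(orthantMeasure (n + 1)) := by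
  have e0 : (δ ^ (n + 1))⁻¹ = Real.exp (-(((n + 1 : ℕ) : ℝ) * Real.log δ)) := by
    rw [Real.exp_neg, Real.exp_nat_mul, Real.exp_log hδ]
  have e1 : ∀ᵐ t ∂(orthantMeasure (n + 1)),
      ENNReal.ofReal (Real.exp (l t) * (c * z (fun j => δ * t j)) ^ m) =
      ENNReal.ofReal (Real.exp (m * (Real.log c - θ * Real.log δ))) *
        ENNReal.ofReal (Real.exp (l fun j => δ * t j) * z (fun j => δ * t j) ^ m) := by
    filter_upwards [ae_orthant_pos (n + 1)] with t ht
    rw [← ENNReal.ofReal_mul (Real.exp_pos _).le, hlh t ht, Real.mul_rpow hc.le (hz0 _),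
      Real.rpow_def_of_pos hc, ← mul_assoc, ← mul_assoc, ← Real.exp_add, ← Real.exp_add]
    congr 3
    ring
  rw [lintegral_congr_ae e1, lintegral_const_mul' _ _ ENNReal.ofReal_ne_top,
    lintegral_orthant_smul (n + 1) hδ
      (f := fun t => ENNReal.ofReal (Real.exp (l t) * z t ^ m)) (by fun_prop), ← mul_assoc,
    ← ENNReal.ofReal_mul (Real.exp_pos _).le, e0, ← Real.exp_add]
  congr 3
  field_simp
  ring

section
variable {n : ℕ} {p q r θ θ₀ θ₁ γ s : ℝ} (H : Parameters (n + 1) p q r θ θ₀ θ₁ γ s)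
include H

lemma lintegral_le_of_energy_le {z : (Fin (n + 1) → ℝ) → ℝ} (hz : Measurable z)
    (hz0 : ∀ t, 0 ≤ z t)
    (hleft : ∫⁻ t, ENNReal.ofReal (Real.exp (p * (θ₀ * logRadius t)) * z t ^ p)
      ∂(orthantMeasure (n + 1)) ≤ ENNReal.ofReal (γ * energy (n + 1) p r θ₀ θ₁ γ s))
    (hright : ∫⁻ t, ENNReal.ofReal (Real.exp (logPowerSum (r * θ₁) t) * z t ^ r)
      ∂(orthantMeasure (n + 1)) ≤ ENNReal.ofReal ((1 - γ) * energy (n + 1) p r θ₀ θ₁ γ s)) :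
    ∫⁻ t, ENNReal.ofReal (Real.exp (q * (θ * logRadius t)) * z t ^ q) ∂(orthantMeasure (n + 1)) ≤
      ENNReal.ofReal (energy (n + 1) p r θ₀ θ₁ γ s) := by
  have hp := H.p_pos
  have hr := H.r_pos
  have hq := H.q_pos
  have hE := energy_pos H
  have hγ := H.γ_pos
  have hγ' := H.γ'_pos
  have hqp : 0 ≤ 1 - q / p := sub_nonneg.2 ((div_le_one hp).2 H.le_left)
  have hqr : 0 ≤ 1 - q / r := sub_nonneg.2 ((div_le_one hr).2 H.le_right)
  have hqp' : 0 ≤ q / p := (div_pos hq hp).le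
  have hqr' : 0 ≤ q / r := (div_pos hq hr).le
  have hy := measurable_extremal (n := n) (p := p) (q := q) (r := r) (θ := θ) (θ₀ := θ₀)
    (θ₁ := θ₁) (γ := γ) (s := s)
  have hy0 := fun e t => Real.rpow_nonneg (extremal_nonneg (n := n) (p := p) (q := q) (r := r)
    (θ := θ) (θ₀ := θ₀) (θ₁ := θ₁) (γ := γ) (s := s) t) e
  have hz0' := fun e t => Real.rpow_nonneg (hz0 t) e
  set E := energy (n + 1) p r θ₀ θ₁ γ s
  calc _ ≤ ∫⁻ t, (ENNReal.ofReal (1 - q / p) *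
        ENNReal.ofReal (Real.exp (p * (θ₀ * logRadius t)) * extremal p q r θ θ₀ θ₁ γ s t ^ p) +
        ENNReal.ofReal (1 - q / r) * ENNReal.ofReal (Real.exp (logPowerSum (r * θ₁) t) *
          extremal p q r θ θ₀ θ₁ γ s t ^ r)) +
        (ENNReal.ofReal (q / p) *
          ENNReal.ofReal (Real.exp (p * (θ₀ * logRadius t)) * z t ^ p) +
        ENNReal.ofReal (q / r) *
          ENNReal.ofReal (Real.exp (logPowerSum (r * θ₁) t) * z t ^ r))
        ∂(orthantMeasure (n + 1)) := by
        refine lintegral_mono fun t => ?_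
        have h1 := mul_nonneg (Real.exp_pos (p * (θ₀ * logRadius t))).le (hy0 p t)
        have h2 := mul_nonneg (Real.exp_pos (logPowerSum (r * θ₁) t)).le (hy0 r t)
        have h3 := mul_nonneg (Real.exp_pos (p * (θ₀ * logRadius t))).le (hz0' p t)
        have h4 := mul_nonneg (Real.exp_pos (logPowerSum (r * θ₁) t)).le (hz0' r t)
        rw [← ENNReal.ofReal_mul hqp, ← ENNReal.ofReal_mul hqr, ← ENNReal.ofReal_mul hqp',
          ← ENNReal.ofReal_mul hqr',
          ← ENNReal.ofReal_add (mul_nonneg hqp h1) (mul_nonneg hqr h2),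
          ← ENNReal.ofReal_add (mul_nonneg hqp' h3) (mul_nonneg hqr' h4),
          ← ENNReal.ofReal_add (by positivity) (by positivity)]
        exact ENNReal.ofReal_le_ofReal (extremal_pointwise hq H.le_left H.le_right H.gap H.mem
          H.s_pos H.s_eq (θ * logRadius t) (θ₀ * logRadius t) (logPowerSum (r * θ₁) t) (hz0 t))
    _ = (ENNReal.ofReal (1 - q / p) * ENNReal.ofReal (γ * E) +
          ENNReal.ofReal (1 - q / r) * ENNReal.ofReal ((1 - γ) * E)) +
        (ENNReal.ofReal (q / p) *
          ∫⁻ t, ENNReal.ofReal (Real.exp (p * (θ₀ * logRadius t)) * z t ^ p)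
            ∂(orthantMeasure (n + 1)) +
        ENNReal.ofReal (q / r) *
          ∫⁻ t, ENNReal.ofReal (Real.exp (logPowerSum (r * θ₁) t) * z t ^ r)
            ∂(orthantMeasure (n + 1))) := by
        rw [lintegral_add_left (by fun_prop), lintegral_add_left (by fun_prop),
          lintegral_add_left (by fun_prop), lintegral_const_mul' _ _ ENNReal.ofReal_ne_top,
          lintegral_const_mul' _ _ ENNReal.ofReal_ne_top,
          lintegral_const_mul' _ _ ENNReal.ofReal_ne_top,
          lintegral_const_mul' _ _ ENNReal.ofReal_ne_top, lintegral_extremal_left H,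
          lintegral_extremal_right H]
    _ ≤ (ENNReal.ofReal (1 - q / p) * ENNReal.ofReal (γ * E) +
          ENNReal.ofReal (1 - q / r) * ENNReal.ofReal ((1 - γ) * E)) +
        (ENNReal.ofReal (q / p) * ENNReal.ofReal (γ * E) +
          ENNReal.ofReal (q / r) * ENNReal.ofReal ((1 - γ) * E)) := by gcongr
    _ = ENNReal.ofReal E := by
        rw [← ENNReal.ofReal_mul hqp, ← ENNReal.ofReal_mul hqr, ← ENNReal.ofReal_mul hqp',
          ← ENNReal.ofReal_mul hqr', ← ENNReal.ofReal_add (by positivity) (by positivity),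
          ← ENNReal.ofReal_add (by positivity) (by positivity),
          ← ENNReal.ofReal_add (by positivity) (by positivity)]
        congr 1
        ring

/-- The inequality for a nonnegative measurable function, with powers of the norms. -/
lemma lintegral_le_of_le {z : (Fin (n + 1) → ℝ) → ℝ} (hz : Measurable z)
    (hz0 : ∀ t, 0 ≤ z t) {N₀ N₁ : ℝ} (hN₀ : 0 < N₀) (hN₁ : 0 < N₁)
    (hleft : ∫⁻ t, ENNReal.ofReal (Real.exp (p * (θ₀ * logRadius t)) * z t ^ p)
      ∂(orthantMeasure (n + 1)) ≤ ENNReal.ofReal N₀)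
    (hright : ∫⁻ t, ENNReal.ofReal (Real.exp (logPowerSum (r * θ₁) t) * z t ^ r)
      ∂(orthantMeasure (n + 1)) ≤ ENNReal.ofReal N₁) :
    ∫⁻ t, ENNReal.ofReal (Real.exp (q * (θ * logRadius t)) * z t ^ q) ∂(orthantMeasure (n + 1)) ≤
      ENNReal.ofReal (energy (n + 1) p r θ₀ θ₁ γ s *
        ((N₀ / (γ * energy (n + 1) p r θ₀ θ₁ γ s)) ^ (q * γ / p) *
        (N₁ / ((1 - γ) * energy (n + 1) p r θ₀ θ₁ γ s)) ^ (q * (1 - γ) / r))) := by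
  have hp := H.p_pos
  have hr := H.r_pos
  have hq := H.q_pos
  have hs := H.s_pos
  have hE := energy_pos H
  have hγ := H.γ_pos
  have hγ' := H.γ'_pos
  have hτ := sub_ne_zero.2 H.ne
  have e1 : 1 / s = 1 / q - γ / p - (1 - γ) / r := by
    have h1 := H.s_eq
    field_simp at h1 ⊢
    linarith
  have e2 : θ + ((n + 1 : ℕ) : ℝ) / q = γ * (θ₀ + ((n + 1 : ℕ) : ℝ) / p) +
      (1 - γ) * (θ₁ + ((n + 1 : ℕ) : ℝ) / r) := by
    have h2 := H.degree
    have : θ = γ * θ₀ + (1 - γ) * θ₁ - ((n + 1 : ℕ) : ℝ) * (1 / q - γ / p - (1 - γ) / r) := by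
      rw [← e1]
      field_simp
      linarith
    rw [this]
    ring
  set E := energy (n + 1) p r θ₀ θ₁ γ s
  set D : ℝ := ((n + 1 : ℕ) : ℝ)
  set τ₀ := θ₀ + D / p
  set τ₁ := θ₁ + D / r
  set A := Real.log (γ * E / N₀) / p with hA
  set B := Real.log ((1 - γ) * E / N₁) / r with hB
  -- Rescaling as c z(δt) multiplies the constraint energies by exp(p(log c - τ₀ log δ)) and
  -- exp(r(log c - τ₁ log δ)). Setting the brackets equal to A and B turns the bounds N₀, N₁ into γE
  -- and (1-γ)E; this linear system is solvable because τ₀ ≠ τ₁.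
  set δ := Real.exp ((A - B) / (τ₁ - τ₀)) with hδ
  set c := Real.exp (A + τ₀ * ((A - B) / (τ₁ - τ₀))) with hc
  have hδ0 : 0 < δ := Real.exp_pos _
  have hc0 : 0 < c := Real.exp_pos _
  have hA' : Real.log c - τ₀ * Real.log δ = A := by
    rw [hδ, hc, Real.log_exp, Real.log_exp]
    ring
  have hB' : Real.log c - τ₁ * Real.log δ = B := by
    rw [hδ, hc, Real.log_exp, Real.log_exp]
    field_simp
    ring
  have hpA : Real.exp (p * A) = γ * E / N₀ := by
    rw [hA, mul_div_cancel₀ _ hp.ne', Real.exp_log (by positivity)]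
  have hrB : Real.exp (r * B) = (1 - γ) * E / N₁ := by
    rw [hB, mul_div_cancel₀ _ hr.ne', Real.exp_log (by positivity)]
  have hm : Measurable fun t : Fin (n + 1) → ℝ => c * z (fun j => δ * t j) :=
    (hz.comp (f := fun (t : Fin (n + 1) → ℝ) j => δ * t j) (by fun_prop)).const_mul c
  have h1 := lintegral_scaled n (θ := θ₀) hp hc0 hδ0
    (l := fun t => p * (θ₀ * logRadius t)) (by fun_prop)
    (fun t ht => by rw [logRadius_smul hδ0 ht]; ring) hz hz0
  have h2 := lintegral_scaled n (θ := θ₁) hr hc0 hδ0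
    (l := logPowerSum (r * θ₁)) (by fun_prop)
    (fun t ht => by rw [logPowerSum_smul _ hδ0 ht]) hz hz0
  have h3 := lintegral_scaled n (θ := θ) hq hc0 hδ0
    (l := fun t => q * (θ * logRadius t)) (by fun_prop)
    (fun t ht => by rw [logRadius_smul hδ0 ht]; ring) hz hz0
  have key := lintegral_le_of_energy_le H hm (fun t => mul_nonneg hc0.le (hz0 _))
    (by
      refine h1.trans_le ((mul_le_mul_right hleft _).trans_eq ?_)
      rw [← ENNReal.ofReal_mul (Real.exp_pos _).le, hA', hpA, div_mul_cancel₀ _ hN₀.ne'])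
    (by
      refine h2.trans_le ((mul_le_mul_right hright _).trans_eq ?_)
      rw [← ENNReal.ofReal_mul (Real.exp_pos _).le, hB', hrB, div_mul_cancel₀ _ hN₁.ne'])
  rw [h3] at key
  -- The exponent of the q-energy is the same convex combination as in `e2`, so c and δ drop out of
  -- the final bound.
  have e3 : Real.log c - (θ + D / q) * Real.log δ = γ * A + (1 - γ) * B := by
    rw [e2, ← hA', ← hB']
    ring
  rw [e3] at key
  have e4 : (N₀ / (γ * E)) ^ (q * γ / p) * (N₁ / ((1 - γ) * E)) ^ (q * (1 - γ) / r) =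
      (Real.exp (q * (γ * A + (1 - γ) * B)))⁻¹ := by
    rw [Real.rpow_def_of_pos (by positivity), Real.rpow_def_of_pos (by positivity),
      ← Real.exp_add, ← Real.exp_neg, hA, hB, ← inv_div N₀, ← inv_div N₁, Real.log_inv,
      Real.log_inv]
    congr 1
    field_simp
    ring
  rw [e4]
  have hpos := Real.exp_pos (q * (γ * A + (1 - γ) * B))
  rw [← div_eq_mul_inv, ENNReal.ofReal_div_of_pos hpos,
    ENNReal.le_div_iff_mul_le (Or.inl (by simpa using hpos)) (Or.inl ENNReal.ofReal_ne_top),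
    mul_comm]
  exact key

end

/-! ### Norms -/

section
variable {𝕜 : Type*} [RCLike 𝕜]

lemma weightedNorm_eq {d : ℕ} {m : ℝ} (hm : 0 < m) (w : (Fin d → ℝ) → ℝ) (x : (Fin d → ℝ) → 𝕜) :
    weightedNorm m w x = (∫⁻ t, ‖w t • x t‖ₑ ^ m ∂(orthantMeasure d)) ^ (1 / m) := by
  rw [weightedNorm, eLpNorm_eq_lintegral_rpow_enorm_toReal (by simpa using hm)
    ENNReal.ofReal_ne_top, ENNReal.toReal_ofReal hm.le]

lemma enorm_smul_rpow {m : ℝ} (hm : 0 ≤ m) {a : ℝ} (ha : 0 ≤ a) (x : 𝕜) :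
    ‖a • x‖ₑ ^ m = ENNReal.ofReal (a ^ m * ‖x‖ ^ m) := by
  rw [← ofReal_norm, norm_smul, Real.norm_of_nonneg ha,
    ENNReal.ofReal_rpow_of_nonneg (mul_nonneg ha (norm_nonneg x)) hm,
    Real.mul_rpow ha (norm_nonneg x)]

lemma lintegral_radialWeight (n : ℕ) {m : ℝ} (hm : 0 < m) (θ : ℝ) (x : (Fin (n + 1) → ℝ) → 𝕜) :
    ∫⁻ t, ‖radialWeight (n + 1) θ t • x t‖ₑ ^ m ∂(orthantMeasure (n + 1)) =
      ∫⁻ t, ENNReal.ofReal (Real.exp (m * (θ * logRadius t)) * ‖x t‖ ^ m)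
        ∂(orthantMeasure (n + 1)) := by
  refine lintegral_congr_ae ?_
  filter_upwards [ae_orthant_pos (n + 1)] with t ht
  rw [radialWeight_eq_exp θ ht, enorm_smul_rpow hm.le (Real.exp_pos _).le, ← Real.exp_mul,
    mul_comm _ m]

lemma lintegral_coordWeight (n : ℕ) {m : ℝ} (hm : 0 < m) (θ₁ : ℝ) (j : Fin (n + 1))
    (x : (Fin (n + 1) → ℝ) → 𝕜) :
    ∫⁻ t, ‖coordWeight (n + 1) θ₁ j t • x t‖ₑ ^ m ∂(orthantMeasure (n + 1)) =
      ∫⁻ t, ENNReal.ofReal (t j ^ (m * θ₁) * ‖x t‖ ^ m) ∂(orthantMeasure (n + 1)) := by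
  refine lintegral_congr_ae ?_
  filter_upwards [ae_orthant_pos (n + 1)] with t ht
  rw [coordWeight, enorm_smul_rpow hm.le (Real.rpow_nonneg (ht j).le _),
    ← Real.rpow_mul (ht j).le, mul_comm θ₁]

lemma sum_lintegral_coord (n : ℕ) (m e : ℝ) {z : (Fin (n + 1) → ℝ) → ℝ} (hz : Measurable z)
    (hz0 : ∀ t, 0 ≤ z t) :
    ∑ j, ∫⁻ t, ENNReal.ofReal (t j ^ e * z t ^ m) ∂(orthantMeasure (n + 1)) =
      ∫⁻ t, ENNReal.ofReal (Real.exp (logPowerSum e t) * z t ^ m) ∂(orthantMeasure (n + 1)) := by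
  rw [← lintegral_finsetSum _ fun j _ => by fun_prop]
  refine lintegral_congr_ae ?_
  filter_upwards [ae_orthant_pos (n + 1)] with t ht
  rw [exp_logPowerSum e ht, Finset.sum_mul, ENNReal.ofReal_sum_of_nonneg fun j _ =>
    mul_nonneg (Real.rpow_nonneg (ht j).le _) (Real.rpow_nonneg (hz0 t) _)]

lemma measurable_radialWeight (d : ℕ) (θ : ℝ) : Measurable (radialWeight d θ) := by
  unfold radialWeight
  fun_prop

lemma measurable_coordWeight (d : ℕ) (θ₁ : ℝ) (j : Fin d) : Measurable (coordWeight d θ₁ j) := by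
  unfold coordWeight
  fun_prop

/-- The coordinate energies of a permutation-invariant function agree. -/
lemma lintegral_coord_eq (n : ℕ) {m e : ℝ} {z : (Fin (n + 1) → ℝ) → ℝ} (hz : Measurable z)
    (hsymm : ∀ (σ : Equiv.Perm (Fin (n + 1))) t, z (fun i => t (σ i)) = z t)
    (i j : Fin (n + 1)) :
    ∫⁻ t, ENNReal.ofReal (t i ^ e * z t ^ m) ∂(orthantMeasure (n + 1)) =
      ∫⁻ t, ENNReal.ofReal (t j ^ e * z t ^ m) ∂(orthantMeasure (n + 1)) := by
  have h := measurePreserving_piCongrLeft (α := fun _ : Fin (n + 1) => ℝ)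
    (fun _ => (volume : Measure ℝ).restrict (Ioi 0)) (Equiv.swap i j)
  rw [orthantMeasure_eq_pi, ← h.lintegral_comp (f := fun t => ENNReal.ofReal (t i ^ e * z t ^ m))
    (by fun_prop)]
  refine lintegral_congr fun t => ?_
  have e1 : (MeasurableEquiv.piCongrLeft (fun _ : Fin (n + 1) => ℝ) (Equiv.swap i j)) t =
      fun k => t (Equiv.swap i j k) := by
    funext k
    have := Equiv.piCongrLeft_apply_apply (fun _ : Fin (n + 1) => ℝ) (Equiv.swap i j) t
      (Equiv.swap i j k)
    rwa [Equiv.swap_apply_self] at this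
  rw [e1, hsymm]
  simp only [Equiv.swap_apply_left]

lemma extremal_perm {d : ℕ} (p q r θ θ₀ θ₁ γ s : ℝ) (σ : Equiv.Perm (Fin d)) (t : Fin d → ℝ) :
    extremal p q r θ θ₀ θ₁ γ s (fun i => t (σ i)) = extremal p q r θ θ₀ θ₁ γ s t := by
  unfold extremal logRadius logPowerSum
  rw [Equiv.sum_comp σ fun i => t i ^ 2, Equiv.sum_comp σ fun i => t i ^ (r * θ₁)]

end

/-! ### The constant -/

/-- The sharp constant in terms of the energy. -/
def sharpConstant (d : ℕ) (p r θ₀ θ₁ γ s : ℝ) : ℝ :=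
  γ ^ (-(γ / p)) * ((1 - γ) / d) ^ (-((1 - γ) / r)) * energy d p r θ₀ θ₁ γ s ^ (1 / s)

/-- Writing every positive base as an exponential reduces the claim to an identity between
exponents. It is used with a = u = γ, b = v = 1 - γ, D the dimension, and x, m the two norms. -/
lemma constant_upper_identity {E a b D x m p q r u v s : ℝ} (hE : 0 < E) (ha : 0 < a) (hb : 0 < b)
    (hD : 0 < D) (hx : 0 < x) (hm : 0 < m) (hp : 0 < p) (hq : 0 < q) (hr : 0 < r)
    (hs : 1 / s = 1 / q - u / p - v / r) :
    (E * ((x ^ p / (a * E)) ^ (q * u / p) * (D * m ^ r / (b * E)) ^ (q * v / r))) ^ (1 / q) =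
      a ^ (-(u / p)) * (b / D) ^ (-(v / r)) * E ^ (1 / s) * x ^ u * m ^ v := by
  obtain ⟨E, rfl⟩ : ∃ e, Real.exp e = E := ⟨_, Real.exp_log hE⟩
  obtain ⟨a, rfl⟩ : ∃ e, Real.exp e = a := ⟨_, Real.exp_log ha⟩
  obtain ⟨b, rfl⟩ : ∃ e, Real.exp e = b := ⟨_, Real.exp_log hb⟩
  obtain ⟨D, rfl⟩ : ∃ e, Real.exp e = D := ⟨_, Real.exp_log hD⟩
  obtain ⟨x, rfl⟩ : ∃ e, Real.exp e = x := ⟨_, Real.exp_log hx⟩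
  obtain ⟨m, rfl⟩ : ∃ e, Real.exp e = m := ⟨_, Real.exp_log hm⟩
  simp only [← Real.exp_mul, ← Real.exp_add, ← Real.exp_sub]
  rw [hs]
  congr 1
  field_simp
  ring

lemma constant_lower_identity {E a b D p q r u v s : ℝ} (hE : 0 < E) (ha : 0 < a) (hb : 0 < b)
    (hD : 0 < D) (hp : 0 < p) (hq : 0 < q) (hr : 0 < r)
    (hs : 1 / s = 1 / q - u / p - v / r) :
    a ^ (-(u / p)) * (b / D) ^ (-(v / r)) * E ^ (1 / s) *
      (((a * E) ^ (1 / p)) ^ u * ((b * E / D) ^ (1 / r)) ^ v) = E ^ (1 / q) := by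
  obtain ⟨E, rfl⟩ : ∃ e, Real.exp e = E := ⟨_, Real.exp_log hE⟩
  obtain ⟨a, rfl⟩ : ∃ e, Real.exp e = a := ⟨_, Real.exp_log ha⟩
  obtain ⟨b, rfl⟩ : ∃ e, Real.exp e = b := ⟨_, Real.exp_log hb⟩
  obtain ⟨D, rfl⟩ : ∃ e, Real.exp e = D := ⟨_, Real.exp_log hD⟩
  simp only [← Real.exp_mul, ← Real.exp_add, ← Real.exp_sub]
  rw [hs]
  congr 1
  field_simp
  ring

section
variable {n : ℕ} {p q r θ θ₀ θ₁ γ s : ℝ} (H : Parameters (n + 1) p q r θ θ₀ θ₁ γ s)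
include H

lemma Parameters.one_div_s : 1 / s = 1 / q - γ / p - (1 - γ) / r := by
  have := H.s_pos
  rw [div_eq_iff H.s_pos.ne', mul_comm, H.s_eq]

lemma sharpConstant_pos : 0 < sharpConstant (n + 1) p r θ₀ θ₁ γ s := by
  have := energy_pos H
  have := H.γ_pos
  have := H.γ'_pos
  unfold sharpConstant
  positivity

theorem carlsonInequality (𝕜 : Type*) [RCLike 𝕜] :
    CarlsonInequality 𝕜 (n + 1) p q r θ θ₀ θ₁ γ (1 - γ)
      (ENNReal.ofReal (sharpConstant (n + 1) p r θ₀ θ₁ γ s)) := by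
  intro x h₀ h₁
  have hp := H.p_pos
  have hr := H.r_pos
  have hq := H.q_pos
  have hE := energy_pos H
  have hγ := H.γ_pos
  have hγ' := H.γ'_pos
  have hzero : (∀ᵐ t ∂(orthantMeasure (n + 1)), x t = 0) →
      weightedNorm q (radialWeight (n + 1) θ) x = 0 := by
    intro hx
    rw [weightedNorm, eLpNorm_congr_ae (g := fun _ => (0 : 𝕜))
      (by filter_upwards [hx] with t ht; simp [ht])]
    simp
  -- Measurability of x itself is recovered by dividing by a weight that is almost everywhere
  -- nonzero.
  have hx : AEStronglyMeasurable x (orthantMeasure (n + 1)) := by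
    have hw : Measurable fun t => (radialWeight (n + 1) θ₀ t)⁻¹ :=
      (measurable_radialWeight (n + 1) θ₀).inv
    refine (hw.aestronglyMeasurable.smul h₀.1).congr ?_
    filter_upwards [ae_orthant_pos (n + 1)] with t ht
    have : radialWeight (n + 1) θ₀ t ≠ 0 := by
      rw [radialWeight_eq_exp θ₀ ht]
      exact (Real.exp_pos _).ne'
    simp [smul_smul, this]
  have hX := h₀.2.ne
  have hM : (⨆ j, weightedNorm r (coordWeight (n + 1) θ₁ j) x) ≠ ∞ := by
    obtain ⟨j, hj⟩ := exists_eq_ciSup_of_finite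
      (f := fun j => weightedNorm r (coordWeight (n + 1) θ₁ j) x)
    rw [← hj]
    exact (h₁ j).2.ne
  change weightedNorm p (radialWeight (n + 1) θ₀) x ≠ ∞ at hX
  set X := weightedNorm p (radialWeight (n + 1) θ₀) x with hXdef
  set M := ⨆ j, weightedNorm r (coordWeight (n + 1) θ₁ j) x with hMdef
  -- A vanishing norm forces x = 0 almost everywhere; otherwise both norms are positive, as the
  -- rescaling needs.
  by_cases hX0 : X = 0
  · rw [hzero]
    · exact zero_le
    have := (eLpNorm_eq_zero_iff h₀.1 (by simpa using hp)).1 hX0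
    filter_upwards [this, ae_orthant_pos (n + 1)] with t ht hpos
    rw [radialWeight_eq_exp θ₀ hpos] at ht
    simpa [(Real.exp_pos _).ne'] using ht
  by_cases hM0 : M = 0
  · rw [hzero]
    · exact zero_le
    have h0 : weightedNorm r (coordWeight (n + 1) θ₁ 0) x = 0 :=
      le_antisymm ((le_iSup (fun j => weightedNorm r (coordWeight (n + 1) θ₁ j) x) 0).trans_eq hM0)
        zero_le
    have := (eLpNorm_eq_zero_iff (h₁ 0).1 (by simpa using hr)).1 h0
    filter_upwards [this, ae_orthant_pos (n + 1)] with t ht hpos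
    have hne : t 0 ^ θ₁ ≠ 0 := (Real.rpow_pos_of_pos (hpos 0) _).ne'
    simpa [coordWeight, hne] using ht
  have hX' : 0 < X.toReal := ENNReal.toReal_pos hX0 hX
  have hM' : 0 < M.toReal := ENNReal.toReal_pos hM0 hM
  -- A measurable representative of |x|; the outer absolute value makes it nonnegative everywhere.
  set z : (Fin (n + 1) → ℝ) → ℝ := fun t => |hx.norm.aemeasurable.mk _ t| with hzdef
  have hz : Measurable z := (hx.norm.aemeasurable.measurable_mk).abs
  have hz0 : ∀ t, 0 ≤ z t := fun t => abs_nonneg _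
  have hzx : ∀ᵐ t ∂(orthantMeasure (n + 1)), ‖x t‖ = z t := by
    filter_upwards [hx.norm.aemeasurable.ae_eq_mk] with t ht
    rw [hzdef]
    dsimp only
    rw [← ht, abs_norm]
  have hrad : ∀ (m : ℝ), 0 < m → ∀ e : ℝ, ∫⁻ t, ‖radialWeight (n + 1) e t • x t‖ₑ ^ m
      ∂(orthantMeasure (n + 1)) = ∫⁻ t, ENNReal.ofReal (Real.exp (m * (e * logRadius t)) * z t ^ m)
        ∂(orthantMeasure (n + 1)) := by
    intro m hm e
    rw [lintegral_radialWeight n hm]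
    refine lintegral_congr_ae ?_
    filter_upwards [hzx] with t ht
    rw [ht]
  have hleft : ∫⁻ t, ENNReal.ofReal (Real.exp (p * (θ₀ * logRadius t)) * z t ^ p)
      ∂(orthantMeasure (n + 1)) ≤ ENNReal.ofReal (X.toReal ^ p) := by
    rw [← hrad p hp, ← ENNReal.ofReal_rpow_of_nonneg hX'.le hp.le, ENNReal.ofReal_toReal hX, hXdef,
      weightedNorm_eq hp, ← ENNReal.rpow_mul, one_div_mul_cancel hp.ne', ENNReal.rpow_one]
  have hright : ∫⁻ t, ENNReal.ofReal (Real.exp (logPowerSum (r * θ₁) t) * z t ^ r)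
      ∂(orthantMeasure (n + 1)) ≤ ENNReal.ofReal (((n + 1 : ℕ) : ℝ) * M.toReal ^ r) := by
    rw [← sum_lintegral_coord n r (r * θ₁) hz hz0, ENNReal.ofReal_mul (Nat.cast_nonneg _),
      ENNReal.ofReal_natCast, ← ENNReal.ofReal_rpow_of_nonneg hM'.le hr.le,
      ENNReal.ofReal_toReal hM]
    -- Each of the n + 1 coordinate energies is at most M^r; this is the source of the factor d in
    -- the constant.
    refine (Finset.sum_le_card_nsmul _ _ (M ^ r) fun j _ => ?_).trans_eq (by simp)
    have hj : weightedNorm r (coordWeight (n + 1) θ₁ j) x ≤ M :=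
      le_iSup (fun j => weightedNorm r (coordWeight (n + 1) θ₁ j) x) j
    refine le_trans (le_of_eq ?_) (ENNReal.rpow_le_rpow hj hr.le)
    rw [weightedNorm_eq hr, ← ENNReal.rpow_mul, one_div_mul_cancel hr.ne', ENNReal.rpow_one,
      lintegral_coordWeight n hr]
    refine lintegral_congr_ae ?_
    filter_upwards [hzx] with t ht
    rw [ht]
  have hD : (0 : ℝ) < ((n + 1 : ℕ) : ℝ) := by positivity
  have key := lintegral_le_of_le H hz hz0 (Real.rpow_pos_of_pos hX' p)
    (mul_pos hD (Real.rpow_pos_of_pos hM' r)) hleft hright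
  rw [← hrad q hq] at key
  have key2 := ENNReal.rpow_le_rpow key (one_div_pos.2 hq).le
  rw [← weightedNorm_eq hq, ENNReal.ofReal_rpow_of_pos (by positivity),
    constant_upper_identity hE hγ hγ' hD hX' hM' hp hq hr H.one_div_s] at key2
  refine key2.trans_eq ?_
  have hC := sharpConstant_pos H
  rw [show γ ^ (-(γ / p)) * ((1 - γ) / ((n + 1 : ℕ) : ℝ)) ^ (-((1 - γ) / r)) *
    energy (n + 1) p r θ₀ θ₁ γ s ^ (1 / s) = sharpConstant (n + 1) p r θ₀ θ₁ γ s from rfl,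
    ENNReal.ofReal_mul (by positivity), ENNReal.ofReal_mul hC.le,
    ← ENNReal.ofReal_rpow_of_pos hX', ← ENNReal.ofReal_rpow_of_pos hM',
    ENNReal.ofReal_toReal hX, ENNReal.ofReal_toReal hM]

/-- Test the inequality on the extremal function: its energies are known exactly, and by symmetry
each coordinate energy is (1-γ)E/d. -/
theorem sharpConstant_le (𝕜 : Type*) [RCLike 𝕜] {K : ℝ≥0∞}
    (hK : CarlsonInequality 𝕜 (n + 1) p q r θ θ₀ θ₁ γ (1 - γ) K) :
    ENNReal.ofReal (sharpConstant (n + 1) p r θ₀ θ₁ γ s) ≤ K := by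
  have hp := H.p_pos
  have hr := H.r_pos
  have hq := H.q_pos
  have hE := energy_pos H
  have hγ := H.γ_pos
  have hγ' := H.γ'_pos
  have hD : (0 : ℝ) < ((n + 1 : ℕ) : ℝ) := by positivity
  have hy := measurable_extremal (n := n) (p := p) (q := q) (r := r) (θ := θ) (θ₀ := θ₀)
    (θ₁ := θ₁) (γ := γ) (s := s)
  set y := extremal (d := n + 1) p q r θ θ₀ θ₁ γ s
  have hy0 : ∀ t, 0 ≤ y t := extremal_nonneg
  have hnorm : ∀ t, ‖((y t : ℝ) : 𝕜)‖ = y t := fun t => by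
    rw [RCLike.norm_ofReal, abs_of_nonneg (hy0 t)]
  have hymeas : Measurable fun t => ((y t : ℝ) : 𝕜) := RCLike.measurable_ofReal.comp hy
  have hleft : weightedNorm p (radialWeight (n + 1) θ₀) (fun t => ((y t : ℝ) : 𝕜)) =
      ENNReal.ofReal ((γ * energy (n + 1) p r θ₀ θ₁ γ s) ^ (1 / p)) := by
    rw [weightedNorm_eq hp, lintegral_radialWeight n hp]
    simp_rw [hnorm]
    rw [lintegral_extremal_left H, ENNReal.ofReal_rpow_of_pos (by positivity)]
  have hmain : weightedNorm q (radialWeight (n + 1) θ) (fun t => ((y t : ℝ) : 𝕜)) =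
      ENNReal.ofReal (energy (n + 1) p r θ₀ θ₁ γ s ^ (1 / q)) := by
    rw [weightedNorm_eq hq, lintegral_radialWeight n hq]
    simp_rw [hnorm]
    rw [lintegral_extremal H, ENNReal.ofReal_rpow_of_pos hE]
  have hright : ∀ j, weightedNorm r (coordWeight (n + 1) θ₁ j) (fun t => ((y t : ℝ) : 𝕜)) =
      ENNReal.ofReal (((1 - γ) * energy (n + 1) p r θ₀ θ₁ γ s / ((n + 1 : ℕ) : ℝ)) ^ (1 / r)) := by
    intro j
    rw [weightedNorm_eq hr, lintegral_coordWeight n hr]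
    simp_rw [hnorm]
    rw [← ENNReal.ofReal_rpow_of_pos (by positivity), ENNReal.ofReal_div_of_pos hD,
      ← lintegral_extremal_right H, ← sum_lintegral_coord n r (r * θ₁) hy hy0,
      Finset.sum_congr rfl fun i _ => lintegral_coord_eq n hy
        (extremal_perm p q r θ θ₀ θ₁ γ s) i j]
    congr 1
    rw [Finset.sum_const, Finset.card_univ, Fintype.card_fin, nsmul_eq_mul,
      ENNReal.ofReal_natCast]
    exact ((congrArg (· / _) (mul_comm _ _)).trans (ENNReal.mul_div_cancel_right
      (by simp) (ENNReal.natCast_ne_top _))).symm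
  have h := hK (fun t => ((y t : ℝ) : 𝕜))
    ⟨((measurable_radialWeight _ _).smul hymeas).aestronglyMeasurable,
      (hleft.trans_lt ENNReal.ofReal_lt_top)⟩
    (fun j => ⟨((measurable_coordWeight _ _ j).smul hymeas).aestronglyMeasurable,
      ((hright j).trans_lt ENNReal.ofReal_lt_top)⟩)
  simp_rw [hright] at h
  rw [iSup_const, hleft, hmain, ENNReal.ofReal_rpow_of_pos (by positivity),
    ENNReal.ofReal_rpow_of_pos (by positivity), mul_assoc,
    ← ENNReal.ofReal_mul (by positivity),
    ← constant_lower_identity hE hγ hγ' hD hp hq hr H.one_div_s] at h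
  have hC := sharpConstant_pos H
  rw [show γ ^ (-(γ / p)) * ((1 - γ) / ((n + 1 : ℕ) : ℝ)) ^ (-((1 - γ) / r)) *
    energy (n + 1) p r θ₀ θ₁ γ s ^ (1 / s) = sharpConstant (n + 1) p r θ₀ θ₁ γ s from rfl,
    ENNReal.ofReal_mul hC.le] at h
  refine (ENNReal.mul_le_mul_iff_left ?_ ENNReal.ofReal_ne_top).1 h
  exact (ENNReal.ofReal_pos.2 (by positivity)).ne'

theorem isSharpConstant (𝕜 : Type*) [RCLike 𝕜] :
    IsSharpConstant 𝕜 (n + 1) p q r θ θ₀ θ₁ γ (1 - γ) (sharpConstant (n + 1) p r θ₀ θ₁ γ s) :=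
  ⟨(sharpConstant_pos H).le, carlsonInequality H 𝕜, fun _ hK => sharpConstant_le H 𝕜 hK⟩

end

/-! ### Verification of the parameter relations and the two families of exponents -/

lemma parameters_of_convex {n : ℕ} {p q r : ℝ} (hpqr : (p, q, r) ∈ P ∪ P₁ ∪ P₂) {θ θ₀ θ₁ γ s : ℝ}
    (hθ₁ : 0 < θ₁) (hγ : γ ∈ Ioo (0 : ℝ) 1) (hne : θ₁ + (n + 1 : ℕ) / r ≠ θ₀ + (n + 1 : ℕ) / p)
    (hτ : θ + (n + 1 : ℕ) / q =
      γ * (θ₀ + (n + 1 : ℕ) / p) + (1 - γ) * (θ₁ + (n + 1 : ℕ) / r))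
    (hs : s = 1 / (1 / q - γ / p - (1 - γ) / r)) : Parameters (n + 1) p q r θ θ₀ θ₁ γ s := by
  obtain ⟨h1, hp, hr, hgap⟩ := admissible hpqr
  have hq0 : 0 < q := by linarith
  have hp0 : 0 < p := by linarith
  have hr0 : 0 < r := by linarith
  have hγ0 := hγ.1
  have hγ1 : 0 < 1 - γ := sub_pos.2 hγ.2
  have hpos : 0 < 1 / q - γ / p - (1 - γ) / r := by
    -- Over a common denominator the quantity is a positive combination of p - q ≥ 0 and r - q ≥ 0,
    -- which do not both vanish.
    have : 1 / q - γ / p - (1 - γ) / r =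
        (γ * r * (p - q) + (1 - γ) * p * (r - q)) / (p * q * r) := by
      field_simp
      ring
    rw [this]
    refine div_pos ?_ (by positivity)
    have h2 : 0 ≤ γ * r * (p - q) := mul_nonneg (by positivity) (by linarith)
    have h3 : 0 ≤ (1 - γ) * p * (r - q) := mul_nonneg (by positivity) (by linarith)
    rcases hp.lt_or_eq with hlt | heq
    · have : 0 < γ * r * (p - q) := mul_pos (by positivity) (by linarith)
      linarith
    · have : 0 < (1 - γ) * p * (r - q) := mul_pos (by positivity) (by linarith)
      linarith
  have hs' : s * (1 / q - γ / p - (1 - γ) / r) = 1 := by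
    rw [hs, one_div_mul_cancel hpos.ne']
  refine ⟨h1, hp, hr, hgap, hθ₁, hγ, by rw [hs]; positivity, hs', ?_, hne⟩
  have : θ - γ * θ₀ - (1 - γ) * θ₁ = -((n + 1 : ℕ) * (1 / q - γ / p - (1 - γ) / r)) := by
    linear_combination hτ
  rw [this, mul_neg, mul_left_comm, hs', mul_one]

end Carlson

end

theorem corollary6 {𝕜 : Type*} [RCLike 𝕜] (d : ℕ) (hd : 1 ≤ d) (p q r : ℝ)
    (hpqr : (p, q, r) ∈ Carlson.P ∪ Carlson.P₁ ∪ Carlson.P₂) :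
    -- general exponents
    (∀ θ θ₀ θ₁ : ℝ, 0 < θ₁ →
      ((θ₁ + d * (1 / r - 1 / q) > θ ∧ θ > θ₀ + d * (1 / p - 1 / q)) ∨
        (θ₁ + d * (1 / r - 1 / q) < θ ∧ θ < θ₀ + d * (1 / p - 1 / q))) →
      ∀ τ τ₀ τ₁ γ s : ℝ, τ = θ + d / q → τ₀ = θ₀ + d / p → τ₁ = θ₁ + d / r →
        γ = (τ₁ - τ) / (τ₁ - τ₀) → s = 1 / (1 / q - γ / p - (1 - γ) / r) →
        IntegrableOn (Carlson.angularIntegrand d (r * θ₁) (s * (1 - γ) / r))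
          (Carlson.angularCube d) ∧
        Carlson.IsSharpConstant 𝕜 d p q r θ θ₀ θ₁ γ (1 - γ)
          (γ ^ (-(γ / p)) * ((1 - γ) / d) ^ (-((1 - γ) / r)) *
            (ProbabilityTheory.beta (s * γ / p) (s * (1 - γ) / r) *
                Carlson.angularIntegral d (r * θ₁) (s * (1 - γ) / r) /
              (|τ₁ - τ₀| * (γ * r + (1 - γ) * p))) ^ (1 / s))) ∧
    -- the exponents determined by `lam` and `μ`
    (∀ lam μ : ℝ, 0 < lam → 0 < μ →
      ∀ α β : ℝ, α = μ / (p * μ + r * lam) → β = lam / (p * μ + r * lam) →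
        IntegrableOn (Carlson.angularIntegrand d (d * (r - 1) + μ) (β / (1 / q - α - β)))
          (Carlson.angularCube d) ∧
        Carlson.IsSharpConstant 𝕜 d p q r (d * (1 - 1 / q)) (d - (lam + d) / p)
          (d + (μ - d) / r) (p * α) (r * β)
          ((d : ℝ) ^ β / ((p * α) ^ α * (r * β) ^ β) *
            (Carlson.angularIntegral d (d * (r - 1) + μ) (β / (1 / q - α - β)) / (lam + μ) *
              ProbabilityTheory.beta (α / (1 / q - α - β)) (β / (1 / q - α - β)))
              ^ (1 / q - α - β))) := by
  obtain ⟨n, rfl⟩ : ∃ n, d = n + 1 := ⟨d - 1, by omega⟩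
  obtain ⟨h1, hp, hr, hgap⟩ := Carlson.admissible hpqr
  have hq0 : 0 < q := by linarith
  have hp0 : 0 < p := by linarith
  have hr0 : 0 < r := by linarith
  have hD : (0 : ℝ) < ((n + 1 : ℕ) : ℝ) := by positivity
  refine ⟨?_, ?_⟩
  · intro θ θ₀ θ₁ hθ₁ hcond τ τ₀ τ₁ γ s hτ hτ₀ hτ₁ hγ hs
    have hcond' : (τ < τ₁ ∧ τ₀ < τ) ∨ (τ₁ < τ ∧ τ < τ₀) := by
      have e1 : ∀ a b : ℝ, ((n + 1 : ℕ) : ℝ) * (1 / a - 1 / b) =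
          ((n + 1 : ℕ) : ℝ) / a - ((n + 1 : ℕ) : ℝ) / b := fun a b => by ring
      rw [e1, e1] at hcond
      rcases hcond with h | h
      · left; constructor <;> linarith
      · right; constructor <;> linarith
    have hne : τ₁ - τ₀ ≠ 0 := by
      rcases hcond' with h | h
      · exact ne_of_gt (by linarith)
      · exact ne_of_lt (by linarith)
    have hmem : γ ∈ Ioo (0 : ℝ) 1 := by
      rw [hγ]
      rcases hcond' with h | h
      · exact ⟨div_pos (by linarith) (by linarith), (div_lt_one (by linarith)).2 (by linarith)⟩
      · exact ⟨div_pos_of_neg_of_neg (by linarith) (by linarith),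
          (div_lt_one_of_neg (by linarith)).2 (by linarith)⟩
    have hconv : τ = γ * τ₀ + (1 - γ) * τ₁ := by
      rw [hγ]
      field_simp
      ring
    have H : Carlson.Parameters (n + 1) p q r θ θ₀ θ₁ γ s :=
      Carlson.parameters_of_convex hpqr hθ₁ hmem (by rw [← hτ₀, ← hτ₁]; exact sub_ne_zero.1 hne)
        (by rw [← hτ₀, ← hτ₁, ← hτ]; exact hconv) hs
    refine ⟨Carlson.integrableOn_angularIntegrand n (mul_pos hr0 hθ₁) _, ?_⟩
    subst hτ₀ hτ₁
    exact Carlson.isSharpConstant H 𝕜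
  · intro lam μ hlam hμ α β hα hβ
    have hden : 0 < p * μ + r * lam := by positivity
    -- The second family is the first one with γ = pα and 1 - γ = rβ.
    have hsum : 1 - p * α = r * β := by
      rw [hα, hβ]
      field_simp
      ring
    have hα0 : 0 < α := by rw [hα]; positivity
    have hβ0 : 0 < β := by rw [hβ]; positivity
    have hθ : r * (((n + 1 : ℕ) : ℝ) + (μ - ((n + 1 : ℕ) : ℝ)) / r) =
        ((n + 1 : ℕ) : ℝ) * (r - 1) + μ := by
      field_simp
      ring
    have hθpos : 0 < ((n + 1 : ℕ) : ℝ) * (r - 1) + μ := by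
      have : 0 ≤ ((n + 1 : ℕ) : ℝ) * (r - 1) := mul_nonneg hD.le (by linarith)
      linarith
    have hτd : ((n + 1 : ℕ) : ℝ) + (μ - ((n + 1 : ℕ) : ℝ)) / r + ((n + 1 : ℕ) : ℝ) / r -
        (((n + 1 : ℕ) : ℝ) - (lam + ((n + 1 : ℕ) : ℝ)) / p + ((n + 1 : ℕ) : ℝ) / p) =
        μ / r + lam / p := by ring
    have hs1 : 1 / q - p * α / p - (1 - p * α) / r = 1 / q - α - β := by
      rw [hsum, mul_div_cancel_left₀ _ hp0.ne', mul_div_cancel_left₀ _ hr0.ne']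
    have H : Carlson.Parameters (n + 1) p q r (((n + 1 : ℕ) : ℝ) * (1 - 1 / q))
        (((n + 1 : ℕ) : ℝ) - (lam + ((n + 1 : ℕ) : ℝ)) / p)
        (((n + 1 : ℕ) : ℝ) + (μ - ((n + 1 : ℕ) : ℝ)) / r) (p * α) (1 / (1 / q - α - β)) := by
      refine Carlson.parameters_of_convex hpqr ?_ ⟨by positivity, ?_⟩ ?_ ?_ (by rw [hs1])
      · exact pos_of_mul_pos_right (hθ ▸ hθpos) hr0.le
      · have := mul_pos hr0 hβ0
        linarith
      · refine sub_ne_zero.1 ?_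
        rw [hτd]
        positivity
      · rw [hsum, hα, hβ]
        field_simp
        ring
    refine ⟨Carlson.integrableOn_angularIntegrand n hθpos _, ?_⟩
    have hS := Carlson.isSharpConstant H 𝕜
    have ea : 1 / (1 / q - α - β) * (p * α) / p = α / (1 / q - α - β) := by
      field_simp
    have eb : 1 / (1 / q - α - β) * (r * β) / r = β / (1 / q - α - β) := by
      field_simp
    -- The left side is the denominator of the energy, since τ₁ - τ₀ = μ/r + λ/p is positive.
    have ec : (μ / r + lam / p) * (p * α * r + r * β * p) = lam + μ := by
      rw [hα, hβ]
      field_simp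
      ring
    rw [Carlson.sharpConstant, Carlson.energy, hsum, hτd, hθ, ea, eb,
      abs_of_pos (by positivity), ec, mul_div_cancel_left₀ _ hp0.ne',
      mul_div_cancel_left₀ _ hr0.ne', one_div_one_div] at hS
    convert hS using 1
    rw [Real.rpow_neg (by positivity), Real.rpow_neg (by positivity), Real.div_rpow (by positivity)
      (by positivity)]
    congr 1
    · field_simp
    · congr 1
      ring
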